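/- Let $\mathbb{H}$ be a field with $\mathbb{Q}\subset\mathbb{H}\subset\mathbb{C}$ and let $A\in\mathbb{H}^{n\times n}$ be nonderogatory, i.e. every complex eigenvalue of $A$ has geometric multiplicity one. Let $p_A=g_1^{d_1}\cdots g_r^{d_r}$, $d_j\ge 1$, be the factorization of the characteristic polynomial of $A$ with $g_j\in\mathbb{H}[\lambda]$ monic, irreducible and pairwise coprime, and put $k_j=\deg g_j$. Let $C_{g_j}$ be the companion matrix of $g_j$ (ones on the superdiagonal, the negatives of the coefficients $a_0,\dots,a_{k_j-1}$ of $g_j$ in the last row), and let $C_j$ be the $d_jk_j\times d_jk_j$ block matrix with $d_j$ diagonal blocks $C_{g_j}$, with $I_{k_j}$ in each block directly above the diagonal, and with zeros elsewhere. Let $p(\lambda)=p_0+p_1\lambda+\dots+p_\ell\lambda^\ell\in\mathbb{H}[\lambda]$. Then there is an invertible $T\in\mathbb{H}^{n\times n}$ with $$A=T^{-1}(C_1\oplus\cdots\oplus C_r)T .\qquad (0)$$ For a square matrix $X_1$ over $\mathbb{H}$ put $K(X_1)=\sum_{m=1}^{\ell}p_m\sum_{i=0}^{m-1}(X_1^T)^i\otimes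 X_1^{m-1-i}$. For every $j$ and every $X_1\in\mathbb{H}^{k_j\times k_j}$ with $p(X_1)=C_{g_j}$ the condition $$\det K(X_1)\neq 0\qquad (1)$$ is equivalent to $$\sum_{m=1}^{\ell}p_m\sum_{i=0}^{m-1}\mu_1^i\mu_2^{m-1-i}\neq 0\quad\text{for all complex eigenvalues }\mu_1,\mu_2\text{ of }X_1 .$$ For blocks $X_1,X_2,\dots$ of the same size $k\times k$ consider the equation $$\sum_{m=1}^{\ell}p_m\sum_{i=0}^{m-1}X_1^{m-1-i}X_2X_1^i=I_k \qquad (2)$$ for $X_2$ and, for $s\ge 3$, the equation for $X_s$ $$K(X_1)\,\mathrm{vec}(X_s)=-\mathrm{vec}\Big(\sum_{m=2}^{\ell}p_m\sum_{i=0}^{m-2}\sum_{\nu=0}^{m-i-2}X_1^{m-i-2-\nu}\,[X_2\ \cdots\ X_{s-1}]\,\widetilde X_1^{\nu}\begin{bmatrix}X_{s-1}\\ \vdots\\ X_2\end{bmatrix}X_1^i\Big),\qquad (3)$$ where $\mathrm{vec}$ stacks columns and $\widetilde X_1$ is the block upper triangular Toeplitz matrix with $s-2$ block rows and first block row $[X_1\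 X_2\ \cdots\ X_{s-2}]$. The following hold. (i) If $p(X)=A$ has a solution $X\in\mathbb{H}^{n\times n}$, then for every root $\lambda$ of every $g_j$ there is $\mu\in\mathbb{H}(\lambda)$ with $p(\mu)=\lambda$. (ii) Conversely, if $p(\mu)=\lambda$ has a solution in $\mathbb{H}(\lambda)$ for every eigenvalue $\lambda$ of $A$, then for each $j$ the equation $p(X_{1,j})=C_{g_j}$ has a solution $X_{1,j}\in\mathbb{H}^{k_j\times k_j}$. For each $j$ and each root $\lambda_j$ of $g_j$, the number of solutions of $p(X_{1,j})=C_{g_j}$ over $\mathbb{H}$ equals the number $m_j\in\{0,1,2,\dots,\infty\}$ of solutions $\mu\in\mathbb{H}(\lambda_j)$ of $p(\mu)=\lambda_j$. (iii) Assume that $p(\mu)=\lambda$ has a solution in $\mathbb{H}(\lambda)$ for every eigenvalue $\lambda$ of $A$, and that for each $j$ with $d_j>1$ some solution of $p(X_{1,j})=C_{g_j}$ over $\mathbb{H}$ satisfies (1). Then there is a choice of $X_{1,j}\in\mathbb{H}^{k_j\times k_j}$ ($j=1,\dots,r$) with $p(X_{1,j})=C_{g_j}$, satisfying (1) whenever $d_j>1$.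 For every such choice there are matrices $X_{s,j}\in\mathbb{H}^{k_j\times k_j}$, $2\le s\le d_j$, such that $X_{2,j}$ is the unique solution of (2) and, for $3\le s\le d_j$, $X_{s,j}$ is the unique solution of (3) (all blocks being taken from the $j$-th family); and for every invertible $T\in\mathbb{H}^{n\times n}$ satisfying (0), the matrix $$X=T^{-1}(Y_1\oplus\cdots\oplus Y_r)T\in\mathbb{H}^{n\times n},$$ where $Y_j$ is the block upper triangular Toeplitz matrix with first block row $[X_{1,j}\ X_{2,j}\ \cdots\ X_{d_j,j}]$, is a solution of $p(X)=A$. (iv) If (1) is satisfied for each $j$ with $d_j>1$ and each solution $X_{1,j}\in\mathbb{H}^{k_j\times k_j}$ of $p(X_{1,j})=C_{g_j}$, then $p(X)=A$ has precisely $m_1m_2\cdots m_r$ solutions $X\in\mathbb{H}^{n\times n}$. (v) Let $X_{s,j}\in\mathbb{H}^{k_j\times k_j}$ ($1\le s\le d_j$, $1\le j\le r$) be such that for each $j$ one has $p(X_{1,j})=C_{g_j}$, equation (2) if $d_j\ge2$, and equation (3) for $3\le s\le d_j$, whether or not (1) holds for $X_{1,j}$. Then for every invertible $T\in\mathbb{H}^{n\times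 n}$ satisfying (0), the matrix $X=T^{-1}(Y_1\oplus\cdots\oplus Y_r)T$ formed as in (iii) is a solution of $p(X)=A$. If moreover (1) fails for $X_{1,j}$ for some $j$ with $d_j>1$, then $p(X)=A$ has infinitely many solutions $X\in\mathbb{H}^{n\times n}$. -/

import Mathlib

open Polynomial
open scoped Kronecker IntermediateField

noncomputable section

namespace PolyMatEq

/-- A square matrix over a subfield `H` of `ℂ` is nonderogatory if every (complex) eigenvalue has
geometric multiplicity one. -/
def Nonderogatory {H : Subfield ℂ} {n : ℕ} (A : Matrix (Fin n) (Fin n) H) : Prop :=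
  ∀ z : ℂ, Module.End.HasEigenvalue (Matrix.toLin' (A.map (algebraMap H ℂ))) z →
    Module.finrank ℂ
      (Module.End.eigenspace (Matrix.toLin' (A.map (algebraMap H ℂ))) z) = 1

section Ring

variable {R : Type*} [CommRing R]

/-- The companion matrix of a monic polynomial: ones on the superdiagonal, and
`-a₀, …, -a_{k-1}` in the last row. -/
def companion (g : R[X]) : Matrix (Fin g.natDegree) (Fin g.natDegree) R :=
  Matrix.of fun i j =>
    if (i : ℕ) + 1 = g.natDegree then -g.coeff j
    else if (j : ℕ) = i + 1 then 1 else 0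

/-- The `d × d` block upper triangular Toeplitz matrix with first block row
`X 1, X 2, …, X d` (blocks are numbered from `1`; the other values of `X` are not used). -/
def blockToeplitz {k : ℕ} (d : ℕ) (X : ℕ → Matrix (Fin k) (Fin k) R) :
    Matrix (Fin d × Fin k) (Fin d × Fin k) R :=
  Matrix.of fun a b =>
    if (a.1 : ℕ) ≤ b.1 then X ((b.1 : ℕ) - a.1 + 1) a.2 b.2 else 0

/-- The companion-Jordan block: `C_g` in the diagonal blocks, the identity in the blocks just above
the diagonal, and zero in all other blocks. -/
def companionJordanBlock (d : ℕ) (g : R[X]) :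
    Matrix (Fin d × Fin g.natDegree) (Fin d × Fin g.natDegree) R :=
  Matrix.of fun a b =>
    if (b.1 : ℕ) = a.1 then companion g a.2 b.2
    else if (b.1 : ℕ) = a.1 + 1 then (1 : Matrix (Fin g.natDegree) (Fin g.natDegree) R) a.2 b.2
    else 0

/-- `Δp(W, Y)(Z) = ∑_{m=1}^ℓ p_m ∑_{i=0}^{m-1} W^{m-1-i} Z Y^i`. -/
def Delta {a b : Type*} [Fintype a] [DecidableEq a] [Fintype b] [DecidableEq b]
    (p : R[X]) (W : Matrix a a R) (Y : Matrix b b R) (Z : Matrix a b R) : Matrix a b R :=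
  ∑ m ∈ Finset.Icc 1 p.natDegree,
    p.coeff m • ∑ i ∈ Finset.range m, W ^ (m - 1 - i) * Z * Y ^ i

/-- The coefficient matrix `∑_{m=1}^ℓ p_m ∑_{i=0}^{m-1} (X₁ᵀ)^i ⊗ X₁^{m-1-i}`. -/
def kronCoeff {k : ℕ} (p : R[X]) (X₁ : Matrix (Fin k) (Fin k) R) :
    Matrix (Fin k × Fin k) (Fin k × Fin k) R :=
  ∑ m ∈ Finset.Icc 1 p.natDegree,
    p.coeff m • ∑ i ∈ Finset.range m, (X₁.transpose ^ i) ⊗ₖ (X₁ ^ (m - 1 - i))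

/-- The determinant condition on the diagonal block `X₁`. -/
def DetCondition {k : ℕ} (p : R[X]) (X₁ : Matrix (Fin k) (Fin k) R) : Prop :=
  (kronCoeff p X₁).det ≠ 0

/-- The block row `[X₂ X₃ ⋯ X_{s-1}]`. -/
def blockRow {k : ℕ} (X : ℕ → Matrix (Fin k) (Fin k) R) (s : ℕ) :
    Matrix (Fin k) (Fin (s - 2) × Fin k) R :=
  Matrix.of fun a b => X ((b.1 : ℕ) + 2) a b.2

/-- The block column with blocks `X_{s-1}, …, X₂` from top to bottom. -/
def blockCol {k : ℕ} (X : ℕ → Matrix (Fin k) (Fin k) R) (s : ℕ) :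
    Matrix (Fin (s - 2) × Fin k) (Fin k) R :=
  Matrix.of fun a b => X (s - 1 - (a.1 : ℕ)) a.2 b

/-- The linear equation for the block `Z = X_s`, given `X₁, …, X_{s-1}`.
For `s = 2` it is `Δp(X₁, X₁)(Z) = I`. For `s ≥ 3` it is
`(∑_m p_m ∑_i (X₁ᵀ)^i ⊗ X₁^{m-1-i}) vec Z = - vec (∑_{m=2}^ℓ p_m ∑_{i=0}^{m-2} ∑_{ν=0}^{m-i-2}
  X₁^{m-i-2-ν} [X₂ ⋯ X_{s-1}] (X̃₁)^ν [X_{s-1}; …; X₂] X₁^i)`, where `X̃₁` is the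
`(s-2) × (s-2)` block upper triangular Toeplitz matrix with first block row `X₁, …, X_{s-2}`.
(The equation is only used for `s ≥ 2`.) -/
def StepEquation {k : ℕ} (p : R[X]) (X : ℕ → Matrix (Fin k) (Fin k) R) (s : ℕ)
    (Z : Matrix (Fin k) (Fin k) R) : Prop :=
  if s = 2 then Delta p (X 1) (X 1) Z = 1
  else
    (kronCoeff p (X 1)).mulVec Z.vec =
      -(∑ m ∈ Finset.Icc 2 p.natDegree, p.coeff m •
          ∑ i ∈ Finset.range (m - 1), ∑ ν ∈ Finset.range (m - 1 - i),
            X 1 ^ (m - 2 - i - ν) * blockRow X s * blockToeplitz (s - 2) X ^ ν *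
              blockCol X s * X 1 ^ i).vec

/-- The equivalence between the index set of a direct sum of `r` block matrices, the `j`-th one
having `d j × d j` blocks of size `k j × k j`, and `{0, …, n-1}`, in the usual order. -/
def indexEquiv {r n : ℕ} (d k : Fin r → ℕ) (h : ∑ j, d j * k j = n) :
    (Σ j : Fin r, Fin (d j) × Fin (k j)) ≃ Fin n :=
  ((Equiv.sigmaCongrRight fun _ => finProdFinEquiv).trans finSigmaFinEquiv).trans (finCongr h)

/-- The direct sum `B₁ ⊕ ⋯ ⊕ B_r` as an `n × n` matrix. -/
def directSum {r n : ℕ} {d k : Fin r → ℕ} (h : ∑ j, d j * k j = n)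
    (B : ∀ j, Matrix (Fin (d j) × Fin (k j)) (Fin (d j) × Fin (k j)) R) :
    Matrix (Fin n) (Fin n) R :=
  Matrix.reindex (indexEquiv d k h) (indexEquiv d k h) (Matrix.blockDiagonal' B)

end Ring

/-- The eigenvalue condition `∑_m p_m ∑_i μ₁^i μ₂^{m-1-i} ≠ 0` for all pairs of complex
eigenvalues of `X₁`. -/
def EigenvalueCondition {H : Subfield ℂ} {k : ℕ} (p : H[X]) (X₁ : Matrix (Fin k) (Fin k) H) :
    Prop :=
  ∀ μ₁ ∈ spectrum ℂ (X₁.map (algebraMap H ℂ)), ∀ μ₂ ∈ spectrum ℂ (X₁.map (algebraMap H ℂ)),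
    ∑ m ∈ Finset.Icc 1 p.natDegree,
      (p.coeff m : ℂ) * ∑ i ∈ Finset.range m, μ₁ ^ i * μ₂ ^ (m - 1 - i) ≠ 0

/-- The set of solutions `μ ∈ H(z)` of the scalar equation `p(μ) = z`. -/
def scalarSolutions {H : Subfield ℂ} (p : H[X]) (z : ℂ) : Set ℂ :=
  {μ | μ ∈ H⟮z⟯ ∧ aeval μ p = z}

/-- If the characteristic polynomial is `∏ g_j^{d_j}`, then `∑ d_j deg g_j = n`. -/
theorem size_eq {K : Type*} [Field K] {n r : ℕ} {A : Matrix (Fin n) (Fin n) K}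
    {g : Fin r → K[X]} {d : Fin r → ℕ} (hg : ∀ j, (g j).Monic)
    (hA : A.charpoly = ∏ j, g j ^ d j) : ∑ j, d j * (g j).natDegree = n := by
  have h := congrArg natDegree hA
  rw [Matrix.charpoly_natDegree_eq_dim, Fintype.card_fin,
    natDegree_prod_of_monic _ _ fun j _ => (hg j).pow _] at h
  rw [h]
  exact Finset.sum_congr rfl fun j _ => ((hg j).natDegree_pow _).symm

end PolyMatEq

end

open PolyMatEq

/-!
Since `A` is nonderogatory, its minimal polynomial is its characteristic polynomial, and every
matrix commuting with `A` is a polynomial in `A`. A solution `X` of `p(X) = A` commutes with `A`, so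
solving the equation means solving `p(x) = λ` in `K[λ] / (p_A) ≅ ∏ j, K[λ] / (g_j ^ d_j)`, where `λ`
is the class of the variable. Modulo `g_j` this is the scalar equation in the field `K(λ_j)`, and by
Newton iteration a solution modulo `g_j` lifts uniquely modulo `g_j ^ d_j` if `p'` does not vanish
at it. The kernel of `Z ↦ Δp(X₁, X₁)(Z)` consists of matrices that commute with `p(X₁) = C_{g_j}`,
hence with `X₁`; on those `Δp(X₁, X₁)` is multiplication by `p'(X₁)`, so that the determinant
condition (1) says precisely that `p'(X₁)` is invertible.

Block upper triangular Toeplitz matrices are truncated power series `X₁ + X₂ t + X₃ t² + ⋯` with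
matrix coefficients, and equations (2) and (3) compare the coefficients of
`p(X₁ + X₂ t + ⋯) = C_{g_j} + t`. A solution `X₂` of (2) also commutes with `X₁`, so (2) becomes
`p'(X₁) X₂ = 1`: it forces (1), and (1) cannot fail in (v) for a block with `d_j > 1`.
-/

noncomputable section

namespace PolyMatEq

theorem commute_aeval_right {R A : Type*} [CommSemiring R] [Semiring A] [Algebra R A] {a b : A}
    (h : Commute a b) (q : R[X]) : Commute a (aeval b q) :=
  Algebra.commute_of_mem_adjoin_singleton_of_commute (aeval_mem_adjoin_singleton R b) h

section Cyclic

variable {K V W : Type*} [Field K] [AddCommGroup V] [Module K V] [AddCommGroup W] [Module K W]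

/-- The orbit map `q ↦ q(f) v` of a vector `v` under an endomorphism `f`; the vector is cyclic when
its orbit map is surjective. -/
def orbitMap (f : Module.End K V) (v : V) : K[X] →ₗ[K] V :=
  LinearMap.applyₗ v ∘ₗ (aeval f).toLinearMap

@[simp]
theorem orbitMap_apply (f : Module.End K V) (v : V) (q : K[X]) : orbitMap f v q = aeval f q v :=
  rfl

theorem orbitMap_X_mul (f : Module.End K V) (v : V) (q : K[X]) :
    orbitMap f v (X * q) = f (orbitMap f v q) := by
  simp only [orbitMap_apply, map_mul, aeval_X, Module.End.mul_apply]

theorem exists_ker_orbitMap_eq_span_minpoly [FiniteDimensional K V] (f : Module.End K V) :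
    ∃ v, LinearMap.ker (orbitMap f v) = (Ideal.span {minpoly K f}).restrictScalars K := by
  obtain ⟨v, hv⟩ := Module.exists_ker_toSpanSingleton_eq_annihilator K[X] (Module.AEval' f)
  rw [← span_minpoly_eq_annihilator] at hv
  exact ⟨v, congrArg (Submodule.restrictScalars K) hv⟩

theorem orbitMap_surjective_of_ker_eq [FiniteDimensional K V] {f : Module.End K V} {v : V}
    (hf : (minpoly K f).natDegree = Module.finrank K V)
    (hv : LinearMap.ker (orbitMap f v) = (Ideal.span {minpoly K f}).restrictScalars K) :
    Function.Surjective (orbitMap f v) := by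
  rw [← LinearMap.range_eq_top]
  apply Submodule.eq_top_of_finrank_eq
  rw [← (orbitMap f v).quotKerEquivRange.finrank_eq, hv, ← hf]
  exact finrank_quotient_span_eq_natDegree

theorem exists_aeval_eq_of_commute [FiniteDimensional K V] {f h : Module.End K V}
    (hf : (minpoly K f).natDegree = Module.finrank K V) (hfh : Commute h f) :
    ∃ q : K[X], aeval f q = h := by
  obtain ⟨v, hv⟩ := exists_ker_orbitMap_eq_span_minpoly f
  have hsurj := orbitMap_surjective_of_ker_eq hf hv
  obtain ⟨q, hq⟩ := hsurj (h v)
  refine ⟨q, LinearMap.ext fun w => ?_⟩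
  obtain ⟨s, rfl⟩ := hsurj w
  calc aeval f q (aeval f s v) = aeval f s (aeval f q v) :=
        LinearMap.congr_fun ((Commute.all q s).map (aeval f)) v
    _ = aeval f s (h v) := by rw [← hq, orbitMap_apply]
    _ = h (aeval f s v) := (LinearMap.congr_fun (commute_aeval_right hfh s) v).symm

theorem exists_linearEquiv_apply_eq_of_ker_eq {P : Type*} [AddCommGroup P] [Module K P]
    {φ : P →ₗ[K] V} {ψ : P →ₗ[K] W} (hφ : Function.Surjective φ) (hψ : Function.Surjective ψ)
    (h : LinearMap.ker φ = LinearMap.ker ψ) : ∃ e : V ≃ₗ[K] W, ∀ x, e (φ x) = ψ x := by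
  refine ⟨(φ.quotKerEquivOfSurjective hφ).symm ≪≫ₗ Submodule.quotEquivOfEq _ _ h ≪≫ₗ
    ψ.quotKerEquivOfSurjective hψ, fun x => ?_⟩
  rw [← φ.quotKerEquivOfSurjective_apply_mk hφ, LinearEquiv.trans_apply,
    LinearEquiv.trans_apply, LinearEquiv.symm_apply_apply]
  rfl

theorem exists_linearEquiv_comp_eq_of_minpoly_eq [FiniteDimensional K V] [FiniteDimensional K W]
    {f : Module.End K V} {g : Module.End K W} (hf : (minpoly K f).natDegree = Module.finrank K V)
    (hg : (minpoly K g).natDegree = Module.finrank K W) (hfg : minpoly K f = minpoly K g) :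
    ∃ e : V ≃ₗ[K] W, ∀ x, e (f x) = g (e x) := by
  obtain ⟨v, hv⟩ := exists_ker_orbitMap_eq_span_minpoly f
  obtain ⟨w, hw⟩ := exists_ker_orbitMap_eq_span_minpoly g
  have hsurj := orbitMap_surjective_of_ker_eq hf hv
  obtain ⟨e, he⟩ := exists_linearEquiv_apply_eq_of_ker_eq hsurj
    (orbitMap_surjective_of_ker_eq hg hw) (by rw [hv, hw, hfg])
  refine ⟨e, fun x => ?_⟩
  obtain ⟨q, rfl⟩ := hsurj x
  rw [← orbitMap_X_mul, he, he, orbitMap_X_mul]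

end Cyclic

section CyclicMatrix

variable {K n : Type*} [Field K] [Fintype n] [DecidableEq n]

theorem exists_aeval_eq_of_commute_matrix {M N : Matrix n n K}
    (hM : (minpoly K M).natDegree = Fintype.card n) (hNM : Commute N M) :
    ∃ q : K[X], aeval M q = N := by
  obtain ⟨q, hq⟩ := exists_aeval_eq_of_commute (f := Matrix.toLinAlgEquiv' M)
    (by rw [← Module.finrank_fintype_fun_eq_card K, ← Matrix.minpoly_toLin'] at hM; exact hM)
    (hNM.map Matrix.toLinAlgEquiv')
  exact ⟨q, Matrix.toLinAlgEquiv'.injective (by rw [← hq, aeval_algHom_apply])⟩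

theorem exists_isUnit_mul_eq_mul_of_minpoly_eq {M N : Matrix n n K}
    (hM : (minpoly K M).natDegree = Fintype.card n) (hMN : minpoly K M = minpoly K N) :
    ∃ T : Matrix n n K, IsUnit T ∧ T * M = N * T := by
  have hN := hMN ▸ hM
  rw [← Module.finrank_fintype_fun_eq_card K, ← Matrix.minpoly_toLin'] at hM hN
  obtain ⟨e, he⟩ := exists_linearEquiv_comp_eq_of_minpoly_eq hM hN
    (by rw [Matrix.minpoly_toLin', Matrix.minpoly_toLin', hMN])
  have hunit : IsUnit (LinearMap.toMatrix' e.toLinearMap) :=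
    .of_mul_eq_one (LinearMap.toMatrix' e.symm.toLinearMap) (by
      rw [← LinearMap.toMatrix'_comp, LinearEquiv.comp_coe, LinearEquiv.symm_trans_self,
        LinearEquiv.refl_toLinearMap, LinearMap.toMatrix'_id])
  refine ⟨_, hunit, Matrix.toLin'.injective (LinearMap.ext fun x => ?_)⟩
  rw [Matrix.toLin'_mul, Matrix.toLin'_mul, Matrix.toLin'_toMatrix']
  exact he x

end CyclicMatrix

section Nonderogatory

variable {K V : Type*} [Field K] [AddCommGroup V] [Module K V] [FiniteDimensional K V]

theorem finrank_ker_mul_le (a b : Module.End K V) :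
    Module.finrank K (LinearMap.ker (a * b)) ≤
      Module.finrank K (LinearMap.ker a) + Module.finrank K (LinearMap.ker b) := by
  let φ := b.domRestrict (LinearMap.ker (a * b))
  have hrange : LinearMap.range φ ≤ LinearMap.ker a := by
    rintro _ ⟨x, rfl⟩
    exact x.2
  have hker : LinearMap.ker φ = (LinearMap.ker b).comap (LinearMap.ker (a * b)).subtype := by
    rw [LinearMap.ker_domRestrict]
  have hle : LinearMap.ker b ≤ LinearMap.ker (a * b) := LinearMap.ker_le_ker_comp b a
  calc Module.finrank K (LinearMap.ker (a * b))
      = Module.finrank K (LinearMap.range φ) + Module.finrank K (LinearMap.ker φ) :=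
        φ.finrank_range_add_finrank_ker.symm
    _ ≤ Module.finrank K (LinearMap.ker a) + Module.finrank K (LinearMap.ker b) := by
        rw [hker, (Submodule.comapSubtypeEquivOfLe hle).finrank_eq]
        exact Nat.add_le_add_right (Submodule.finrank_mono hrange) _

theorem finrank_ker_aeval_prod_le {f : Module.End K V}
    (hf : ∀ z, Module.finrank K (f.eigenspace z) ≤ 1) (s : Multiset K) :
    Module.finrank K (LinearMap.ker (aeval f (s.map fun z => X - C z).prod)) ≤ s.card := by
  induction s using Multiset.induction_on with
  | empty => rw [Multiset.map_zero, Multiset.prod_zero, map_one, Module.End.one_eq_id,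
      LinearMap.ker_id, finrank_bot, Multiset.card_zero]
  | cons z s ih =>
    have hz : aeval f (X - C z) = f - z • 1 := by
      rw [map_sub, aeval_X, aeval_C, Algebra.algebraMap_eq_smul_one]
    rw [Multiset.map_cons, Multiset.prod_cons, map_mul, Multiset.card_cons, add_comm]
    refine (finrank_ker_mul_le _ _).trans (add_le_add ?_ ih)
    rw [hz, ← Module.End.eigenspace_def]
    exact hf z

theorem finrank_le_natDegree_of_aeval_eq_zero {f : Module.End K V}
    (hf : ∀ z, Module.finrank K (f.eigenspace z) ≤ 1) {q : K[X]} (hq : q.Monic) (hsplit : q.Splits)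
    (h0 : aeval f q = 0) : Module.finrank K V ≤ q.natDegree := by
  have h := finrank_ker_aeval_prod_le hf q.roots
  rw [← hsplit.eq_prod_roots_of_monic hq, h0, LinearMap.ker_zero, finrank_top] at h
  exact h.trans (card_roots' q)

theorem Nonderogatory.minpoly_eq_charpoly {H : Subfield ℂ} {n : ℕ}
    {A : Matrix (Fin n) (Fin n) H} (hA : Nonderogatory A) : minpoly H A = A.charpoly := by
  have hmonic := minpoly.monic (Matrix.isIntegral A)
  have heig (z : ℂ) : Module.finrank ℂ
      (Module.End.eigenspace (Matrix.toLin' (A.map (algebraMap H ℂ))) z) ≤ 1 := by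
    by_cases h : Module.End.HasEigenvalue (Matrix.toLin' (A.map (algebraMap H ℂ))) z
    · exact (hA z h).le
    · have hbot : Module.End.eigenspace (Matrix.toLin' (A.map (algebraMap H ℂ))) z = ⊥ :=
        not_not.mp h
      rw [hbot, finrank_bot]
      exact zero_le_one
  let φ : Matrix (Fin n) (Fin n) H →ₐ[H] Module.End ℂ (Fin n → ℂ) :=
    (Matrix.toLinAlgEquiv'.toAlgHom.restrictScalars H).comp (Algebra.ofId H ℂ).mapMatrix
  have hzero : aeval (φ A) ((minpoly H A).map (algebraMap H ℂ)) = 0 := by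
    rw [aeval_map_algebraMap, aeval_algHom_apply, minpoly.aeval, map_zero]
  have hdeg := finrank_le_natDegree_of_aeval_eq_zero heig (hmonic.map (algebraMap H ℂ))
    (IsAlgClosed.splits _) hzero
  refine (eq_of_monic_of_dvd_of_natDegree_le hmonic A.charpoly_monic
    (Matrix.minpoly_dvd_charpoly A) ?_).symm
  rwa [natDegree_map, Module.finrank_fintype_fun_eq_card, ← A.charpoly_natDegree_eq_dim] at hdeg

end Nonderogatory

section Companion

variable {R : Type*} [CommRing R] {g : R[X]}

theorem minpolyGen_powerBasis' [Nontrivial R] (hg : g.Monic) :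
    (AdjoinRoot.powerBasis' hg).minpolyGen = g := by
  refine eq_of_monic_of_dvd_of_natDegree_le hg (PowerBasis.minpolyGen_monic _) ?_ ?_
  · rw [← AdjoinRoot.mk_eq_zero, ← AdjoinRoot.aeval_eq]
    exact (AdjoinRoot.powerBasis' hg).aeval_minpolyGen
  · rw [PowerBasis.natDegree_minpolyGen, AdjoinRoot.powerBasis'_dim]

theorem companion_eq_transpose_leftMulMatrix (hg : g.Monic) :
    companion g =
      (Algebra.leftMulMatrix (AdjoinRoot.powerBasisAux' hg) (AdjoinRoot.root g)).transpose := by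
  cases subsingleton_or_nontrivial R
  · exact Subsingleton.elim _ _
  have h := (AdjoinRoot.powerBasis' hg).leftMulMatrix
  rw [minpolyGen_powerBasis' hg] at h
  exact (congrArg Matrix.transpose h).symm

theorem aeval_transpose {n : Type*} [Fintype n] [DecidableEq n] (M : Matrix n n R) (q : R[X]) :
    aeval M.transpose q = (aeval M q).transpose := by
  simp only [aeval_eq_sum_range, Matrix.transpose_sum, Matrix.transpose_smul, Matrix.transpose_pow]

theorem aeval_companion_eq_zero_iff (hg : g.Monic) {q : R[X]} :
    aeval (companion g) q = 0 ↔ g ∣ q := by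
  rw [companion_eq_transpose_leftMulMatrix hg, aeval_transpose, Matrix.transpose_eq_zero,
    aeval_algHom_apply, map_eq_zero_iff _ (Algebra.leftMulMatrix_injective _), AdjoinRoot.aeval_eq,
    AdjoinRoot.mk_eq_zero]

theorem minpoly_companion {K : Type*} [Field K] {g : K[X]} (hg : g.Monic) :
    minpoly K (companion g) = g :=
  eq_of_monic_of_associated (minpoly.monic (Matrix.isIntegral _)) hg
    (associated_of_dvd_dvd (minpoly.dvd _ _ ((aeval_companion_eq_zero_iff hg).mpr dvd_rfl))
      ((aeval_companion_eq_zero_iff hg).mp (minpoly.aeval _ _)))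

end Companion

section Delta

variable {R : Type*} [CommRing R] {a b : Type*} [Fintype a] [DecidableEq a] [Fintype b]
  [DecidableEq b]

theorem aeval_eq_algebraMap_add_sum {A : Type*} [Ring A] [Algebra R A] (p : R[X]) (x : A) :
    aeval x p = algebraMap R A (p.coeff 0) +
      ∑ m ∈ Finset.Icc 1 p.natDegree, p.coeff m • x ^ m := by
  rw [aeval_eq_sum_range, Finset.range_eq_Ico, Finset.sum_eq_sum_Ico_succ_bot (Nat.succ_pos _),
    pow_zero, Algebra.algebraMap_eq_smul_one]
  rfl

theorem aeval_derivative_eq_sum {A : Type*} [Ring A] [Algebra R A] (p : R[X]) (x : A) :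
    aeval x (derivative p) = ∑ m ∈ Finset.Icc 1 p.natDegree, p.coeff m • (m • x ^ (m - 1)) := by
  conv_lhs => rw [p.as_sum_range_C_mul_X_pow, Finset.range_eq_Ico,
    Finset.sum_eq_sum_Ico_succ_bot (Nat.succ_pos _)]
  simp only [map_add, map_sum, derivative_C_mul_X_pow, aeval_C, map_mul, map_pow, aeval_X,
    Nat.cast_zero, mul_zero, map_zero, zero_mul, zero_add, map_natCast, mul_assoc,
    Algebra.smul_def]
  rfl

theorem mul_delta_sub_delta_mul (p : R[X]) (W : Matrix a a R) (Y : Matrix b b R)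
    (Z : Matrix a b R) :
    W * Delta p W Y Z - Delta p W Y Z * Y = aeval W p * Z - Z * aeval Y p := by
  have htelescope (m : ℕ) : W * (∑ i ∈ Finset.range m, W ^ (m - 1 - i) * Z * Y ^ i) -
      (∑ i ∈ Finset.range m, W ^ (m - 1 - i) * Z * Y ^ i) * Y = W ^ m * Z - Z * Y ^ m := by
    have hterm (i : ℕ) (hi : i ∈ Finset.range m) :
        W * (W ^ (m - 1 - i) * Z * Y ^ i) - W ^ (m - 1 - i) * Z * Y ^ i * Y =
          W ^ (m - i) * Z * Y ^ i - W ^ (m - (i + 1)) * Z * Y ^ (i + 1) := by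
      rw [Finset.mem_range] at hi
      rw [← Matrix.mul_assoc, ← Matrix.mul_assoc, ← pow_succ', Matrix.mul_assoc _ _ Y, ← pow_succ,
        show m - 1 - i + 1 = m - i by omega, show m - (i + 1) = m - 1 - i by omega]
    rw [Matrix.mul_sum, Matrix.sum_mul, ← Finset.sum_sub_distrib, Finset.sum_congr rfl hterm,
      Finset.sum_range_sub' fun i => W ^ (m - i) * Z * Y ^ i]
    simp only [Nat.sub_zero, Nat.sub_self, pow_zero, Matrix.mul_one, Matrix.one_mul]
  rw [aeval_eq_algebraMap_add_sum, aeval_eq_algebraMap_add_sum, Matrix.add_mul, Matrix.mul_add,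
    Algebra.algebraMap_eq_smul_one, Algebra.algebraMap_eq_smul_one, Matrix.smul_mul,
    Matrix.mul_smul, Matrix.one_mul, Matrix.mul_one, add_sub_add_left_eq_sub, Delta]
  simp only [Matrix.mul_sum, Matrix.sum_mul, Matrix.mul_smul, Matrix.smul_mul,
    ← Finset.sum_sub_distrib, ← smul_sub, ← htelescope]

theorem delta_apply_of_commute (p : R[X]) {M Z : Matrix a a R} (h : Commute Z M) :
    Delta p M M Z = aeval M (derivative p) * Z := by
  rw [Delta, aeval_derivative_eq_sum, Finset.sum_mul]
  refine Finset.sum_congr rfl fun m _ => ?_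
  have hterm (i : ℕ) (hi : i ∈ Finset.range m) :
      M ^ (m - 1 - i) * Z * M ^ i = M ^ (m - 1) * Z := by
    rw [Finset.mem_range] at hi
    rw [mul_assoc, (h.pow_right i).eq, ← mul_assoc, ← pow_add, show m - 1 - i + i = m - 1 by omega]
  rw [Finset.sum_congr rfl hterm, Finset.sum_const, Finset.card_range, smul_mul_assoc,
    smul_mul_assoc]

theorem commute_aeval_of_commute_delta {p : R[X]} {M Z : Matrix a a R}
    (h : Commute M (Delta p M M Z)) : Commute Z (aeval M p) := by
  have hzero := mul_delta_sub_delta_mul p M M Z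
  rw [h.eq, sub_self, eq_comm, sub_eq_zero] at hzero
  exact hzero.symm

end Delta

section DeltaOperator

variable {R : Type*} [CommRing R] {a b : Type*} [Fintype a] [DecidableEq a] [Fintype b]
  [DecidableEq b]

/-- `Δp(W, Y)` as a linear operator, so that it has a kernel and can be commuted with left and
right multiplication. -/
def deltaLinearMap (p : R[X]) (W : Matrix a a R) (Y : Matrix b b R) :
    Module.End R (Matrix a b R) where
  toFun := Delta p W Y
  map_add' Z Z' := by
    simp only [Delta, Matrix.mul_add, Matrix.add_mul, Finset.sum_add_distrib, smul_add]
  map_smul' r Z := by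
    simp only [Delta, Matrix.mul_smul, Matrix.smul_mul, ← Finset.smul_sum, RingHom.id_apply,
      smul_comm _ r]

theorem commute_mulLeft_deltaLinearMap (p : R[X]) (M : Matrix a a R) :
    Commute (LinearMap.mulLeft R M) (deltaLinearMap p M M) := by
  refine LinearMap.ext fun Z => ?_
  change M * Delta p M M Z = Delta p M M (M * Z)
  simp only [Delta, Finset.mul_sum, mul_smul_comm]
  refine Finset.sum_congr rfl fun m _ => congrArg _ (Finset.sum_congr rfl fun i _ => ?_)
  rw [← mul_assoc, ← mul_assoc, ← mul_assoc, ← pow_succ, ← pow_succ']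

theorem commute_mulRight_deltaLinearMap (p : R[X]) (M : Matrix a a R) :
    Commute (LinearMap.mulRight R M) (deltaLinearMap p M M) := by
  refine LinearMap.ext fun Z => ?_
  change Delta p M M Z * M = Delta p M M (Z * M)
  simp only [Delta, Finset.sum_mul, smul_mul_assoc]
  refine Finset.sum_congr rfl fun m _ => congrArg _ (Finset.sum_congr rfl fun i _ => ?_)
  rw [mul_assoc, mul_assoc, mul_assoc, mul_assoc, ← pow_succ, ← pow_succ']

theorem pow_mul_eq_smul {A : Type*} [Ring A] [Algebra R A] {x y : A} {r : R} (h : x * y = r • y)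
    (i : ℕ) : x ^ i * y = r ^ i • y := by
  induction i with
  | zero => rw [pow_zero, pow_zero, one_mul, one_smul]
  | succ i ih => rw [pow_succ, mul_assoc, h, mul_smul_comm, ih, smul_smul, pow_succ']

theorem mul_pow_eq_smul {A : Type*} [Ring A] [Algebra R A] {x y : A} {r : R} (h : y * x = r • y)
    (i : ℕ) : y * x ^ i = r ^ i • y := by
  induction i with
  | zero => rw [pow_zero, pow_zero, mul_one, one_smul]
  | succ i ih => rw [pow_succ, ← mul_assoc, ih, smul_mul_assoc, h, smul_smul, pow_succ]

theorem delta_of_mul_eq_smul {p : R[X]} {M Z : Matrix a a R} {μ ν : R}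
    (hμ : M * Z = μ • Z) (hν : Z * M = ν • Z) :
    Delta p M M Z = (∑ m ∈ Finset.Icc 1 p.natDegree,
      p.coeff m * ∑ i ∈ Finset.range m, ν ^ i * μ ^ (m - 1 - i)) • Z := by
  simp only [Delta, pow_mul_eq_smul hμ, smul_mul_assoc, mul_pow_eq_smul hν, Finset.sum_smul,
    mul_smul, smul_comm (μ ^ _)]

theorem kronCoeff_mulVec_vec {k : ℕ} (p : R[X]) (M Z : Matrix (Fin k) (Fin k) R) :
    (kronCoeff p M).mulVec Z.vec = (Delta p M M Z).vec := by
  simp only [kronCoeff, Delta, Matrix.sum_mulVec, Matrix.vec_sum, Matrix.smul_mulVec,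
    Matrix.vec_smul, ← Matrix.transpose_pow, Matrix.kronecker_mulVec_vec,
    Matrix.transpose_transpose]

end DeltaOperator

section DetCondition

variable {K : Type*} [Field K] {k : ℕ} {p : K[X]} {M : Matrix (Fin k) (Fin k) K}

theorem detCondition_iff_ker_deltaLinearMap_eq_bot :
    DetCondition p M ↔ LinearMap.ker (deltaLinearMap p M M) = ⊥ := by
  rw [LinearMap.ker_eq_bot', DetCondition, Ne, ← Matrix.exists_mulVec_eq_zero_iff,
    (Matrix.vec_bijective (m := Fin k) (n := Fin k) (R := K)).surjective.exists]
  simp only [kronCoeff_mulVec_vec, Matrix.vec_eq_zero_iff, ne_eq, not_exists, not_and', not_not]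
  rfl

theorem DetCondition.existsUnique_delta_eq (h : DetCondition p M) (B : Matrix (Fin k) (Fin k) K) :
    ∃! Z, Delta p M M Z = B := by
  have hinj := LinearMap.ker_eq_bot.mp (detCondition_iff_ker_deltaLinearMap_eq_bot.mp h)
  exact Function.Bijective.existsUnique ⟨hinj, LinearMap.injective_iff_surjective.mp hinj⟩ B

theorem detCondition_map {L : Type*} [Field L] [Algebra K L] (p : K[X])
    (M : Matrix (Fin k) (Fin k) K) :
    DetCondition (p.map (algebraMap K L)) (M.map (algebraMap K L)) ↔ DetCondition p M := by
  have hpow (N : Matrix (Fin k) (Fin k) K) (i : ℕ) :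
      N.map (algebraMap K L) ^ i = (N ^ i).map (algebraMap K L) :=
    (map_pow (algebraMap K L).mapMatrix N i).symm
  have hkron : kronCoeff (p.map (algebraMap K L)) (M.map (algebraMap K L)) =
      (algebraMap K L).mapMatrix (kronCoeff p M) := by
    ext x y
    simp only [kronCoeff, natDegree_map, coeff_map, Matrix.sum_apply, Matrix.smul_apply,
      RingHom.mapMatrix_apply, Matrix.map_apply, map_sum, smul_eq_mul, map_mul,
      Matrix.kroneckerMap_apply, ← Matrix.transpose_map, hpow]
  rw [DetCondition, DetCondition, hkron, ← RingHom.map_det, Ne, Ne,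
    map_eq_zero_iff _ (algebraMap K L).injective]

end DetCondition

section Spectrum

variable {K : Type*} [Field K]

theorem exists_mulVec_eq_smul_of_mem_spectrum {n : Type*} [Fintype n] [DecidableEq n]
    {M : Matrix n n K} {μ : K} (h : μ ∈ spectrum K M) : ∃ v ≠ 0, M.mulVec v = μ • v := by
  rw [spectrum.mem_iff, Matrix.isUnit_iff_isUnit_det, isUnit_iff_ne_zero, not_not,
    ← Matrix.exists_mulVec_eq_zero_iff] at h
  obtain ⟨v, hv, h⟩ := h
  refine ⟨v, hv, ?_⟩
  rwa [Matrix.sub_mulVec, sub_eq_zero, Algebra.algebraMap_eq_smul_one, Matrix.smul_mulVec,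
    Matrix.one_mulVec, eq_comm] at h

theorem exists_vecMul_eq_smul_of_mem_spectrum {n : Type*} [Fintype n] [DecidableEq n]
    {M : Matrix n n K} {μ : K} (h : μ ∈ spectrum K M) : ∃ v ≠ 0, M.vecMul v = μ • v := by
  rw [spectrum.mem_iff, Matrix.isUnit_iff_isUnit_det, isUnit_iff_ne_zero, not_not,
    ← Matrix.exists_vecMul_eq_zero_iff] at h
  obtain ⟨v, hv, h⟩ := h
  refine ⟨v, hv, ?_⟩
  rwa [Matrix.vecMul_sub, sub_eq_zero, Algebra.algebraMap_eq_smul_one, Matrix.vecMul_smul,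
    Matrix.vecMul_one, eq_comm] at h

theorem mem_spectrum_of_mul_eq_smul {A : Type*} [Ring A] [Algebra K A] {x y : A} {μ : K}
    (hy : y ≠ 0) (h : x * y = μ • y) : μ ∈ spectrum K x := fun hu => hy <| by
  rw [← hu.mul_right_eq_zero, sub_mul, h, Algebra.smul_def, sub_self]

theorem mem_spectrum_of_mul_eq_smul' {A : Type*} [Ring A] [Algebra K A] {x y : A} {μ : K}
    (hy : y ≠ 0) (h : y * x = μ • y) : μ ∈ spectrum K x := fun hu => hy <| by
  rw [← hu.mul_left_eq_zero, mul_sub, h, ← Algebra.commutes, Algebra.smul_def, sub_self]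

theorem exists_eigenvector_mem_of_mapsTo [IsAlgClosed K] {V : Type*} [AddCommGroup V] [Module K V]
    [FiniteDimensional K V] {f : Module.End K V} {W : Submodule K V} (hW : W ≠ ⊥)
    (hf : Set.MapsTo f W W) : ∃ μ : K, ∃ x ∈ W, x ≠ 0 ∧ f x = μ • x := by
  have : Nontrivial W := Submodule.nontrivial_iff_ne_bot.mpr hW
  obtain ⟨μ, hμ⟩ := Module.End.exists_eigenvalue (f.restrict hf)
  obtain ⟨x, hx⟩ := hμ.exists_hasEigenvector
  exact ⟨μ, x, x.2, fun h => hx.2 (Subtype.ext h), congrArg Subtype.val hx.apply_eq_smul⟩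

theorem exists_common_eigenvector_mem_of_mapsTo [IsAlgClosed K] {V : Type*} [AddCommGroup V]
    [Module K V] [FiniteDimensional K V] {f g : Module.End K V} (hfg : Commute f g)
    {W : Submodule K V} (hW : W ≠ ⊥) (hf : Set.MapsTo f W W) (hg : Set.MapsTo g W W) :
    ∃ μ ν : K, ∃ x ∈ W, x ≠ 0 ∧ f x = μ • x ∧ g x = ν • x := by
  obtain ⟨μ, x, hxW, hx0, hx⟩ := exists_eigenvector_mem_of_mapsTo hW hf
  have hne : W ⊓ f.eigenspace μ ≠ ⊥ :=
    (Submodule.ne_bot_iff _).mpr ⟨x, ⟨hxW, Module.End.mem_eigenspace_iff.mpr hx⟩, hx0⟩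
  obtain ⟨ν, y, hy, hy0, hgy⟩ := exists_eigenvector_mem_of_mapsTo hne
    (hg.inter_inter (Module.End.mapsTo_genEigenspace_of_comm hfg μ 1))
  exact ⟨μ, ν, y, hy.1, hy0, Module.End.mem_eigenspace_iff.mp hy.2, hgy⟩

theorem mapsTo_ker_of_commute {V : Type*} [AddCommGroup V] [Module K V] {f g : Module.End K V}
    (h : Commute f g) : Set.MapsTo f (LinearMap.ker g) (LinearMap.ker g) := fun x hx => by
  rw [SetLike.mem_coe, LinearMap.mem_ker] at hx ⊢
  rw [← Module.End.mul_apply, ← h.eq, Module.End.mul_apply, hx, map_zero]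

theorem detCondition_iff_forall_mem_spectrum [IsAlgClosed K] {k : ℕ} {p : K[X]}
    {M : Matrix (Fin k) (Fin k) K} :
    DetCondition p M ↔ ∀ μ ∈ spectrum K M, ∀ ν ∈ spectrum K M,
      ∑ m ∈ Finset.Icc 1 p.natDegree,
        p.coeff m * ∑ i ∈ Finset.range m, μ ^ i * ν ^ (m - 1 - i) ≠ 0 := by
  rw [detCondition_iff_ker_deltaLinearMap_eq_bot]
  constructor
  · intro hker μ hμ ν hν h0
    obtain ⟨u, hu, hMu⟩ := exists_mulVec_eq_smul_of_mem_spectrum hν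
    obtain ⟨w, hw, hwM⟩ := exists_vecMul_eq_smul_of_mem_spectrum hμ
    have hdelta : Delta p M M (Matrix.vecMulVec u w) = 0 := by
      rw [delta_of_mul_eq_smul (μ := ν) (ν := μ), h0, zero_smul]
      · rw [Matrix.mul_vecMulVec, hMu, Matrix.smul_vecMulVec]
      · rw [Matrix.vecMulVec_mul, hwM, Matrix.vecMulVec_smul]
    exact (Matrix.vecMulVec_eq_zero.mp (LinearMap.ker_eq_bot'.mp hker _ hdelta)).elim hu hw
  · intro h
    by_contra hker
    obtain ⟨ν, μ, Z, hZ, hZ0, hν, hμ⟩ := exists_common_eigenvector_mem_of_mapsTo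
      (LinearMap.commute_mulLeft_right M M) hker
      (mapsTo_ker_of_commute (commute_mulLeft_deltaLinearMap p M))
      (mapsTo_ker_of_commute (commute_mulRight_deltaLinearMap p M))
    have hdelta : Delta p M M Z = 0 := hZ
    rw [delta_of_mul_eq_smul hν hμ] at hdelta
    exact (smul_eq_zero.mp hdelta).elim (h μ (mem_spectrum_of_mul_eq_smul' hZ0 hμ) ν
      (mem_spectrum_of_mul_eq_smul hZ0 hν)) hZ0

end Spectrum

section Toeplitz

theorem coeff_mul_eq_sum_fin {A : Type*} [Semiring A] {d : ℕ} (F G : PowerSeries A) (b : Fin d) :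
    PowerSeries.coeff b (F * G) =
      ∑ c : Fin d, PowerSeries.coeff c F * PowerSeries.coeff b (PowerSeries.X ^ (c : ℕ) * G) := by
  have hterm (c : Fin d) :
      PowerSeries.coeff c F * PowerSeries.coeff b (PowerSeries.X ^ (c : ℕ) * G) =
        if (c : ℕ) ∈ Finset.range (b + 1) then
          PowerSeries.coeff c F * PowerSeries.coeff (b - c) G else 0 := by
    simp only [PowerSeries.coeff_X_pow_mul', mul_ite, mul_zero, Finset.mem_range, Nat.lt_succ_iff]
  rw [Finset.sum_congr rfl fun c _ => hterm c,
    Fin.sum_univ_eq_sum_range (fun c => if c ∈ Finset.range (b + 1) then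
      PowerSeries.coeff c F * PowerSeries.coeff (b - c) G else 0),
    Finset.sum_ite_mem, Finset.inter_eq_right.mpr (Finset.range_subset_range.mpr b.2),
    PowerSeries.coeff_mul, Finset.Nat.sum_antidiagonal_eq_sum_range_succ fun i j =>
      PowerSeries.coeff i F * PowerSeries.coeff j G]

/-- The upper triangular Toeplitz matrix of a power series: row `a` lists the first `d` coefficients
of `X ^ a * F`. It encodes the computation with `F` modulo `X ^ d`. -/
def toeplitz (R : Type*) {A : Type*} [CommRing R] [Ring A] [Algebra R A] (d : ℕ) :
    PowerSeries A →ₐ[R] Matrix (Fin d) (Fin d) A :=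
  AlgHom.ofLinearMap
    { toFun := fun F => Matrix.of fun a b => PowerSeries.coeff b (PowerSeries.X ^ (a : ℕ) * F)
      map_add' := fun F G => by
        ext a b
        simp only [Matrix.of_apply, Matrix.add_apply, mul_add, map_add]
      map_smul' := fun r F => by
        ext a b
        simp only [Matrix.of_apply, Matrix.smul_apply, mul_smul_comm, PowerSeries.coeff_smul,
          RingHom.id_apply] }
    (by
      ext a b
      simp only [LinearMap.coe_mk, AddHom.coe_mk, Matrix.of_apply, mul_one,
        PowerSeries.coeff_X_pow, Matrix.one_apply, Fin.ext_iff, eq_comm])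
    (fun F G => by
      ext a b
      simp only [LinearMap.coe_mk, AddHom.coe_mk, Matrix.of_apply, Matrix.mul_apply, ← mul_assoc,
        coeff_mul_eq_sum_fin (PowerSeries.X ^ (a : ℕ) * F) G b])

variable {R A : Type*} [CommRing R] [Ring A] [Algebra R A]

theorem toeplitz_apply {d : ℕ} (F : PowerSeries A) (a b : Fin d) :
    toeplitz R d F a b =
      if (a : ℕ) ≤ b then PowerSeries.coeff ((b : ℕ) - a) F else 0 :=
  PowerSeries.coeff_X_pow_mul' F a b

theorem toeplitz_eq_iff {d : ℕ} {F G : PowerSeries A} :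
    toeplitz R d F = toeplitz R d G ↔ ∀ i < d, PowerSeries.coeff i F = PowerSeries.coeff i G := by
  refine ⟨fun h i hi => ?_, fun h => ?_⟩
  · simpa only [toeplitz_apply, Nat.zero_le, if_true, Nat.sub_zero] using
      congrFun (congrFun h ⟨0, by omega⟩) ⟨i, hi⟩
  · ext a b
    rw [toeplitz_apply, toeplitz_apply, h _ ((Nat.sub_le _ _).trans_lt b.2)]

variable {k : ℕ}

/-- The block Toeplitz matrix of a power series with matrix coefficients, with the nested matrix of
`toeplitz` flattened to one indexed by pairs. -/
def flatToeplitz (d : ℕ) : PowerSeries (Matrix (Fin k) (Fin k) R) →ₐ[R]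
    Matrix (Fin d × Fin k) (Fin d × Fin k) R :=
  (Matrix.compAlgEquiv (Fin d) (Fin k) R R).toAlgHom.comp (toeplitz R d)

theorem flatToeplitz_apply {d : ℕ} (F : PowerSeries (Matrix (Fin k) (Fin k) R))
    (a b : Fin d × Fin k) :
    flatToeplitz d F a b =
      if (a.1 : ℕ) ≤ b.1 then PowerSeries.coeff ((b.1 : ℕ) - a.1) F a.2 b.2 else 0 := by
  refine (congrFun (congrFun (toeplitz_apply (R := R) F a.1 b.1) a.2) b.2).trans ?_
  split_ifs <;> rfl

theorem flatToeplitz_eq_iff {d : ℕ} {F G : PowerSeries (Matrix (Fin k) (Fin k) R)} :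
    flatToeplitz d F = flatToeplitz d G ↔
      ∀ i < d, PowerSeries.coeff i F = PowerSeries.coeff i G :=
  (Matrix.compAlgEquiv (Fin d) (Fin k) R R).injective.eq_iff.trans (toeplitz_eq_iff (R := R))

theorem blockToeplitz_eq_flatToeplitz (d : ℕ) (X : ℕ → Matrix (Fin k) (Fin k) R) :
    blockToeplitz d X = flatToeplitz d (PowerSeries.mk fun n => X (n + 1)) := by
  ext a b
  rw [flatToeplitz_apply, PowerSeries.coeff_mk]
  rfl

theorem companionJordanBlock_eq_flatToeplitz (d : ℕ) (g : R[X]) :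
    companionJordanBlock d g =
      flatToeplitz d (PowerSeries.C (companion g) + PowerSeries.X) := by
  ext ⟨a, i⟩ ⟨b, j⟩
  simp only [flatToeplitz_apply, map_add, PowerSeries.coeff_C, PowerSeries.coeff_X,
    companionJordanBlock, Matrix.of_apply]
  rcases lt_trichotomy (b : ℕ) a with h | h | h
  · simp only [h.ne, (Nat.lt_succ_of_lt h).ne, not_le_of_gt h, if_false]
  · simp only [h, le_refl, if_true, Nat.sub_self, Nat.zero_ne_one, if_false, add_zero]
  · simp only [h.ne', h.le, Nat.sub_ne_zero_of_lt h, Nat.sub_eq_iff_eq_add h.le, add_comm 1,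
      if_true, if_false, zero_add]
    split_ifs <;> rfl

end Toeplitz

section PowExpansion

variable {A : Type*} [Ring A]

theorem pow_eq_add_sum_left (x y : A) (m : ℕ) :
    y ^ m = x ^ m + ∑ i ∈ Finset.range m, x ^ (m - 1 - i) * (y - x) * y ^ i := by
  have hterm (i : ℕ) (hi : i ∈ Finset.range m) : x ^ (m - 1 - i) * (y - x) * y ^ i =
      x ^ (m - (i + 1)) * y ^ (i + 1) - x ^ (m - i) * y ^ i := by
    rw [Finset.mem_range] at hi
    rw [mul_sub, sub_mul, mul_assoc, ← pow_succ', ← pow_succ, show m - 1 - i + 1 = m - i by omega,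
      show m - 1 - i = m - (i + 1) by omega]
  rw [Finset.sum_congr rfl hterm, Finset.sum_range_sub fun i => x ^ (m - i) * y ^ i, Nat.sub_self,
    Nat.sub_zero, pow_zero, pow_zero, one_mul, mul_one, add_sub_cancel]

theorem pow_eq_add_sum_right (x y : A) (m : ℕ) :
    y ^ m = x ^ m + ∑ i ∈ Finset.range m, y ^ (m - 1 - i) * (y - x) * x ^ i := by
  rw [pow_eq_add_sum_left y x m, add_assoc, ← Finset.sum_add_distrib, left_eq_add]
  exact Finset.sum_eq_zero fun i _ => by noncomm_ring

theorem pow_eq_add_sum_add_sum (x y : A) (m : ℕ) :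
    y ^ m = x ^ m + ∑ i ∈ Finset.range m, x ^ (m - 1 - i) * (y - x) * x ^ i +
      ∑ i ∈ Finset.range (m - 1), ∑ ν ∈ Finset.range (m - 1 - i),
        x ^ (m - 2 - i - ν) * (y - x) * y ^ ν * (y - x) * x ^ i := by
  have hrange : ∑ i ∈ Finset.range (m - 1), ∑ ν ∈ Finset.range (m - 1 - i),
      x ^ (m - 2 - i - ν) * (y - x) * y ^ ν * (y - x) * x ^ i =
      ∑ i ∈ Finset.range m, ∑ ν ∈ Finset.range (m - 1 - i),
        x ^ (m - 2 - i - ν) * (y - x) * y ^ ν * (y - x) * x ^ i := by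
    refine Finset.sum_subset (Finset.range_subset_range.mpr (Nat.sub_le _ _)) fun i _ hi => ?_
    rw [Finset.mem_range, not_lt] at hi
    rw [Nat.sub_eq_zero_of_le hi, Finset.sum_range_zero]
  rw [hrange, add_assoc, ← Finset.sum_add_distrib, pow_eq_add_sum_right x y m]
  refine congrArg _ (Finset.sum_congr rfl fun i _ => ?_)
  rw [pow_eq_add_sum_left x y (m - 1 - i), add_mul, add_mul, Finset.sum_mul, Finset.sum_mul]
  refine congrArg _ (Finset.sum_congr rfl fun ν _ => ?_)
  rw [show m - 1 - i - 1 - ν = m - 2 - i - ν by omega]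

end PowExpansion

section StepEquation

variable {R : Type*} [CommRing R] {k : ℕ}

theorem coeff_X_mul_mul_X_mul {A : Type*} [Semiring A] (F Q G : PowerSeries A) (n : ℕ) :
    PowerSeries.coeff n ((PowerSeries.X * F) * Q * (PowerSeries.X * G)) =
      if 2 ≤ n then PowerSeries.coeff (n - 2) (F * Q * G) else 0 := by
  rw [← PowerSeries.coeff_X_pow_mul', sq]
  simp only [mul_assoc, ← mul_assoc _ PowerSeries.X G, (PowerSeries.commute_X _).eq]

theorem blockRow_mul_flatToeplitz_mul_blockCol_of_le (X : ℕ → Matrix (Fin k) (Fin k) R) {s : ℕ}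
    (hs : 3 ≤ s) (Q : PowerSeries (Matrix (Fin k) (Fin k) R)) :
    blockRow X s * flatToeplitz (s - 2) Q * blockCol X s =
      PowerSeries.coeff (s - 3) ((PowerSeries.mk fun n => X (n + 2)) * Q *
        PowerSeries.mk fun n => X (n + 2)) := by
  set G : PowerSeries (Matrix (Fin k) (Fin k) R) := PowerSeries.mk fun n => X (n + 2) with hG
  let first : Fin (s - 2) := ⟨0, by omega⟩
  let last : Fin (s - 2) := ⟨s - 3, by omega⟩
  ext i j
  have hrow (b) : blockRow X s i b = flatToeplitz (s - 2) G (first, i) b := by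
    rw [flatToeplitz_apply, if_pos (Nat.zero_le _), hG, PowerSeries.coeff_mk]
    rfl
  have hcol (a) : blockCol X s a j = flatToeplitz (s - 2) G a (last, j) := by
    have ha : (a.1 : ℕ) < s - 2 := a.1.2
    rw [flatToeplitz_apply, if_pos (show (a.1 : ℕ) ≤ s - 3 by omega), hG, PowerSeries.coeff_mk,
      show s - 3 - (a.1 : ℕ) + 2 = s - 1 - a.1 by omega]
    rfl
  have hcorner : PowerSeries.coeff (s - 3) (G * Q * G) i j =
      flatToeplitz (s - 2) (G * Q * G) (first, i) (last, j) := by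
    rw [flatToeplitz_apply, if_pos (Nat.zero_le _)]
    rfl
  simp only [hcorner, map_mul, Matrix.mul_apply, hrow, hcol]

theorem blockRow_eq_zero (X : ℕ → Matrix (Fin k) (Fin k) R) {s : ℕ} (hs : s ≤ 2) :
    blockRow X s = 0 := by
  ext a b
  have := b.1.2
  omega

theorem blockRow_mul_flatToeplitz_mul_blockCol (X : ℕ → Matrix (Fin k) (Fin k) R) (s : ℕ)
    (Q : PowerSeries (Matrix (Fin k) (Fin k) R)) :
    blockRow X s * flatToeplitz (s - 2) Q * blockCol X s =
      PowerSeries.coeff (s - 1) ((PowerSeries.X * PowerSeries.mk fun n => X (n + 2)) * Q *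
        (PowerSeries.X * PowerSeries.mk fun n => X (n + 2))) := by
  rw [coeff_X_mul_mul_X_mul]
  split_ifs with hs
  · exact blockRow_mul_flatToeplitz_mul_blockCol_of_le X (by omega) Q
  · rw [blockRow_eq_zero X (by omega), Matrix.zero_mul, Matrix.zero_mul]

/-- The part of the coefficient of `t ^ (s - 1)` in `p(X₁ + X₂ t + X₃ t² + ⋯)` that does not
involve `X_s`, in the form in which it occurs in `StepEquation`. -/
def stepRemainder (p : R[X]) (X : ℕ → Matrix (Fin k) (Fin k) R) (s : ℕ) :
    Matrix (Fin k) (Fin k) R :=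
  ∑ m ∈ Finset.Icc 2 p.natDegree, p.coeff m •
    ∑ i ∈ Finset.range (m - 1), ∑ ν ∈ Finset.range (m - 1 - i),
      X 1 ^ (m - 2 - i - ν) * blockRow X s * blockToeplitz (s - 2) X ^ ν *
        blockCol X s * X 1 ^ i

theorem stepRemainder_two (p : R[X]) (X : ℕ → Matrix (Fin k) (Fin k) R) :
    stepRemainder p X 2 = 0 := by
  rw [stepRemainder, blockRow_eq_zero X le_rfl]
  simp only [Matrix.mul_zero, Matrix.zero_mul, Finset.sum_const_zero, smul_zero]

theorem stepRemainder_congr (p : R[X]) {X X' : ℕ → Matrix (Fin k) (Fin k) R} {s : ℕ} (hs : 2 ≤ s)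
    (h : ∀ t, 1 ≤ t → t < s → X t = X' t) : stepRemainder p X s = stepRemainder p X' s := by
  have hrow : blockRow X s = blockRow X' s := by
    ext a b
    have := b.1.2
    exact congrFun (congrFun (h _ (by omega) (by omega)) a) b.2
  have hcol : blockCol X s = blockCol X' s := by
    ext a b
    have := a.1.2
    exact congrFun (congrFun (h _ (by omega) (by omega)) a.2) b
  have htoeplitz : blockToeplitz (s - 2) X = blockToeplitz (s - 2) X' := by
    ext a b
    have := b.1.2
    simp only [blockToeplitz, Matrix.of_apply]
    rw [h _ (by omega) (by omega)]
  rw [stepRemainder, stepRemainder, hrow, hcol, htoeplitz, h 1 le_rfl hs]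

theorem mk_sub_C_eq_X_mul_mk {A : Type*} [Ring A] (x : ℕ → A) :
    (PowerSeries.mk fun n => x (n + 1)) - PowerSeries.C (x 1) =
      PowerSeries.X * PowerSeries.mk fun n => x (n + 2) := by
  rw [sub_eq_iff_eq_add, PowerSeries.eq_X_mul_shift_add_const (PowerSeries.mk fun n => x (n + 1))]
  simp only [PowerSeries.coeff_mk, ← PowerSeries.coeff_zero_eq_constantCoeff_apply]

theorem coeff_mk_pow (X : ℕ → Matrix (Fin k) (Fin k) R) {s : ℕ} (hs : 2 ≤ s) (m : ℕ) :
    PowerSeries.coeff (s - 1) ((PowerSeries.mk fun n => X (n + 1)) ^ m) =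
      ∑ i ∈ Finset.range m, X 1 ^ (m - 1 - i) * X s * X 1 ^ i +
      ∑ i ∈ Finset.range (m - 1), ∑ ν ∈ Finset.range (m - 1 - i),
        X 1 ^ (m - 2 - i - ν) * blockRow X s * blockToeplitz (s - 2) X ^ ν *
          blockCol X s * X 1 ^ i := by
  have hs' : s - 1 ≠ 0 := by omega
  have hcoeff : PowerSeries.coeff (s - 1) ((PowerSeries.mk fun n => X (n + 1)) -
      PowerSeries.C (X 1)) = X s := by
    rw [map_sub, PowerSeries.coeff_C, if_neg hs', PowerSeries.coeff_mk, sub_zero,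
      Nat.sub_add_cancel (by omega)]
  rw [pow_eq_add_sum_add_sum (PowerSeries.C (X 1)), map_add, map_add, map_sum, map_sum, ← map_pow,
    PowerSeries.coeff_C, if_neg hs', zero_add]
  simp only [← map_pow, map_sum, PowerSeries.coeff_mul_C, PowerSeries.coeff_C_mul, hcoeff,
    mul_assoc (PowerSeries.C _)]
  simp only [mk_sub_C_eq_X_mul_mk, ← blockRow_mul_flatToeplitz_mul_blockCol, map_pow,
    ← blockToeplitz_eq_flatToeplitz, Matrix.mul_assoc]

theorem coeff_aeval_mk (p : R[X]) (X : ℕ → Matrix (Fin k) (Fin k) R) {s : ℕ} (hs : 2 ≤ s) :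
    PowerSeries.coeff (s - 1) (aeval (PowerSeries.mk fun n => X (n + 1)) p) =
      Delta p (X 1) (X 1) (X s) + stepRemainder p X s := by
  have hremainder : stepRemainder p X s = ∑ m ∈ Finset.Icc 1 p.natDegree, p.coeff m •
      ∑ i ∈ Finset.range (m - 1), ∑ ν ∈ Finset.range (m - 1 - i),
        X 1 ^ (m - 2 - i - ν) * blockRow X s * blockToeplitz (s - 2) X ^ ν *
          blockCol X s * X 1 ^ i := by
    refine Finset.sum_subset (Finset.Icc_subset_Icc_left one_le_two) fun m hm hm' => ?_
    obtain rfl : m = 1 := by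
      rw [Finset.mem_Icc] at hm hm'
      omega
    rw [Nat.sub_self, Finset.sum_range_zero, smul_zero]
  rw [aeval_eq_algebraMap_add_sum, map_add, map_sum, hremainder, Delta, ← Finset.sum_add_distrib,
    Algebra.algebraMap_eq_smul_one, PowerSeries.coeff_smul, PowerSeries.coeff_one,
    if_neg (by omega), smul_zero, zero_add]
  simp only [PowerSeries.coeff_smul, coeff_mk_pow X hs, smul_add]

theorem stepEquation_iff (p : R[X]) (X : ℕ → Matrix (Fin k) (Fin k) R) (s : ℕ)
    (Z : Matrix (Fin k) (Fin k) R) : StepEquation p X s Z ↔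
      Delta p (X 1) (X 1) Z = (if s = 2 then 1 else 0) - stepRemainder p X s := by
  rw [StepEquation]
  split_ifs with h
  · rw [h, stepRemainder_two, sub_zero]
  · rw [kronCoeff_mulVec_vec, zero_sub, ← Matrix.vec_inj, Matrix.vec_neg]
    rfl

theorem coeff_zero_aeval {A : Type*} [Ring A] [Algebra R A] (F : PowerSeries A) (p : R[X]) :
    PowerSeries.coeff 0 (aeval F p) = aeval (PowerSeries.coeff 0 F) p := by
  simp only [aeval_eq_sum_range, map_sum, PowerSeries.coeff_smul,
    PowerSeries.coeff_zero_eq_constantCoeff_apply, map_pow]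

theorem aeval_blockToeplitz {p g : R[X]} {d : ℕ}
    {X : ℕ → Matrix (Fin g.natDegree) (Fin g.natDegree) R}
    (h1 : aeval (X 1) p = companion g)
    (hX : ∀ s, 2 ≤ s → s ≤ d → StepEquation p X s (X s)) :
    aeval (blockToeplitz d X) p = companionJordanBlock d g := by
  rw [blockToeplitz_eq_flatToeplitz, companionJordanBlock_eq_flatToeplitz, aeval_algHom_apply,
    flatToeplitz_eq_iff]
  rintro (_ | i) hi
  · rw [coeff_zero_aeval, PowerSeries.coeff_mk, h1, map_add, PowerSeries.coeff_zero_X, add_zero,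
      PowerSeries.coeff_zero_C]
  · have hstep := (stepEquation_iff p X _ _).mp (hX (i + 2) (by omega) (by omega))
    rw [show i + 1 = i + 2 - 1 from rfl, coeff_aeval_mk p X (by omega), hstep, sub_add_cancel]
    simp only [map_add, PowerSeries.coeff_C, PowerSeries.coeff_X, Nat.add_eq_right,
      Nat.add_one_sub_one, Nat.succ_ne_zero, if_false, zero_add]

theorem exists_forall_stepEquation_iff_eq {K : Type*} [Field K] {p : K[X]}
    {M : Matrix (Fin k) (Fin k) K} {d : ℕ} (h : 1 < d → DetCondition p M) :
    ∃ X : ℕ → Matrix (Fin k) (Fin k) K, X 1 = M ∧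
      ∀ s, 2 ≤ s → s ≤ d → ∀ Z, StepEquation p X s Z ↔ Z = X s := by
  induction d with
  | zero => exact ⟨fun _ => M, rfl, fun s h2 h0 => by omega⟩
  | succ d ih =>
    obtain ⟨X, rfl, hX⟩ := ih fun hd => h (hd.trans d.lt_succ_self)
    rcases Nat.lt_or_ge (d + 1) 2 with hd | hd
    · exact ⟨X, rfl, fun s h2 hs => by omega⟩
    obtain ⟨Z₀, hZ₀, hunique⟩ := (h hd).existsUnique_delta_eq
      ((if d + 1 = 2 then 1 else 0) - stepRemainder p X (d + 1))
    have hold (t) (ht : t < d + 1) : Function.update X (d + 1) Z₀ t = X t :=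
      Function.update_of_ne ht.ne _ _
    refine ⟨Function.update X (d + 1) Z₀, hold 1 hd, fun s h2 hs Z => ?_⟩
    rw [stepEquation_iff, stepRemainder_congr p h2 (fun t _ ht => hold t (ht.trans_le hs)),
      hold 1 hd]
    rcases hs.lt_or_eq with hs' | rfl
    · rw [hold s hs', ← hX s h2 (Nat.lt_succ_iff.mp hs') Z, stepEquation_iff]
    · rw [Function.update_self]
      exact ⟨hunique Z, fun hZ => hZ ▸ hZ₀⟩

end StepEquation

section JordanBlockMinpoly

theorem coeff_one_C_add_X_pow {A : Type*} [Ring A] (a : A) (m : ℕ) :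
    PowerSeries.coeff 1 ((PowerSeries.C a + PowerSeries.X) ^ m) = m • a ^ (m - 1) := by
  have hterm (i : ℕ) (hi : i ∈ Finset.range m) : PowerSeries.coeff 1
      ((PowerSeries.C a + PowerSeries.X) ^ (m - 1 - i) * PowerSeries.X * PowerSeries.C a ^ i) =
        a ^ (m - 1) := by
    rw [Finset.mem_range] at hi
    rw [← map_pow, PowerSeries.coeff_mul_C, PowerSeries.coeff_succ_mul_X,
      PowerSeries.coeff_zero_eq_constantCoeff_apply, map_pow, map_add,
      PowerSeries.constantCoeff_C, PowerSeries.constantCoeff_X, add_zero, ← pow_add,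
      show m - 1 - i + i = m - 1 by omega]
  rw [pow_eq_add_sum_right (PowerSeries.C a), add_sub_cancel_left, map_add, map_sum,
    Finset.sum_congr rfl hterm, Finset.sum_const, Finset.card_range, ← map_pow,
    PowerSeries.coeff_C, if_neg one_ne_zero, zero_add]

theorem coeff_one_aeval_C_add_X {R A : Type*} [CommRing R] [Ring A] [Algebra R A] (a : A)
    (q : R[X]) : PowerSeries.coeff 1 (aeval (PowerSeries.C a + PowerSeries.X) q) =
      aeval a (derivative q) := by
  rw [aeval_eq_algebraMap_add_sum, aeval_derivative_eq_sum, map_add, map_sum,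
    Algebra.algebraMap_eq_smul_one, PowerSeries.coeff_smul, PowerSeries.coeff_one,
    if_neg one_ne_zero, smul_zero, zero_add]
  simp only [PowerSeries.coeff_smul, coeff_one_C_add_X_pow]

theorem exists_aeval_C_add_X_eq_X_mul {R A : Type*} [CommRing R] [Ring A] [Algebra R A] {a : A}
    {q : R[X]} (h : aeval a q = 0) : ∃ U : PowerSeries A,
      aeval (PowerSeries.C a + PowerSeries.X) q = PowerSeries.X * U ∧
        PowerSeries.constantCoeff U = aeval a (derivative q) := by
  refine ⟨PowerSeries.mk fun n => PowerSeries.coeff (n + 1)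
    (aeval (PowerSeries.C a + PowerSeries.X) q), ?_, ?_⟩
  · conv_lhs => rw [PowerSeries.eq_X_mul_shift_add_const (aeval _ q)]
    rw [← PowerSeries.coeff_zero_eq_constantCoeff_apply, coeff_zero_aeval, map_add,
      PowerSeries.coeff_zero_C, PowerSeries.coeff_zero_X, add_zero, h, map_zero, add_zero]
  · rw [← PowerSeries.coeff_zero_eq_constantCoeff_apply, PowerSeries.coeff_mk,
      coeff_one_aeval_C_add_X]

theorem isUnit_aeval_of_isCoprime {R A : Type*} [CommRing R] [Ring A] [Algebra R A] {a : A}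
    {f q : R[X]} (hfq : IsCoprime f q) (ha : aeval a f = 0) : IsUnit (aeval a q) := by
  obtain ⟨u, v, huv⟩ := hfq
  have hinv : aeval a (v * q) = 1 := by
    rw [← map_one (aeval (R := R) a), ← huv, map_add, map_mul (aeval a) u, ha, mul_zero, zero_add]
  exact ⟨⟨aeval a q, aeval a v, by rw [← map_mul, mul_comm, hinv], by rw [← map_mul, hinv]⟩, rfl⟩

variable {K : Type*} [Field K] {g : K[X]}

theorem aeval_companionJordanBlock_pow_eq_zero_iff (hg : g.Monic) (hirr : Irreducible g)
    (hsep : g.Separable) {d e : ℕ} :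
    aeval (companionJordanBlock d g) (g ^ e) = 0 ↔ d ≤ e := by
  have : Nonempty (Fin g.natDegree) := ⟨⟨0, hirr.natDegree_pos⟩⟩
  have hroot : aeval (companion g) g = 0 := (aeval_companion_eq_zero_iff hg).mpr dvd_rfl
  obtain ⟨U, hU, hU0⟩ := exists_aeval_C_add_X_eq_X_mul hroot
  have hunit : IsUnit (PowerSeries.constantCoeff U ^ e) :=
    (hU0 ▸ isUnit_aeval_of_isCoprime hsep hroot).pow e
  rw [companionJordanBlock_eq_flatToeplitz, aeval_algHom_apply, map_pow (aeval _), hU,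
    (PowerSeries.commute_X U).symm.mul_pow, ← map_zero (flatToeplitz d), flatToeplitz_eq_iff]
  refine ⟨fun h => ?_, fun h i hi => ?_⟩
  · by_contra! hlt
    have hcoeff := h e hlt
    rw [PowerSeries.coeff_X_pow_mul', if_pos le_rfl, Nat.sub_self, map_zero,
      PowerSeries.coeff_zero_eq_constantCoeff_apply, map_pow] at hcoeff
    exact hunit.ne_zero hcoeff
  · rw [PowerSeries.coeff_X_pow_mul', if_neg (hi.trans_le h).not_ge, map_zero]

theorem minpoly_companionJordanBlock (hg : g.Monic) (hirr : Irreducible g) (hsep : g.Separable)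
    (d : ℕ) : minpoly K (companionJordanBlock d g) = g ^ d := by
  have hzero (e : ℕ) := aeval_companionJordanBlock_pow_eq_zero_iff hg hirr hsep (d := d) (e := e)
  obtain ⟨e, hed, hassoc⟩ := (dvd_prime_pow hirr.prime d).mp
    (minpoly.dvd K (companionJordanBlock d g) ((hzero d).mpr le_rfl))
  have heq := eq_of_monic_of_associated (minpoly.monic (Matrix.isIntegral _)) (hg.pow e) hassoc
  rw [heq, hed.antisymm ((hzero e).mp (heq ▸ minpoly.aeval K _))]

end JordanBlockMinpoly

section DirectSum

theorem aeval_directSum {R : Type*} [CommRing R] {r n : ℕ} {d k : Fin r → ℕ}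
    (h : ∑ j, d j * k j = n)
    (B : ∀ j, Matrix (Fin (d j) × Fin (k j)) (Fin (d j) × Fin (k j)) R) (q : R[X]) :
    aeval (directSum h B) q = directSum h fun j => aeval (B j) q := by
  let φ : (∀ j, Matrix (Fin (d j) × Fin (k j)) (Fin (d j) × Fin (k j)) R) →ₐ[R]
      Matrix (Σ j, Fin (d j) × Fin (k j)) (Σ j, Fin (d j) × Fin (k j)) R :=
    AlgHom.ofLinearMap
      { Matrix.blockDiagonal'AddMonoidHom (fun j => Fin (d j) × Fin (k j)) _ R with
        map_smul' := Matrix.blockDiagonal'_smul }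
      Matrix.blockDiagonal'_one Matrix.blockDiagonal'_mul
  have hdirectSum (B) : directSum h B =
    Matrix.reindexAlgEquiv R R (indexEquiv d k h) (φ B) := rfl
  rw [hdirectSum, hdirectSum, aeval_algHom_apply, aeval_algHom_apply, aeval_pi_apply]

theorem directSum_eq_zero_iff {R : Type*} [CommRing R] {r n : ℕ} {d k : Fin r → ℕ}
    (h : ∑ j, d j * k j = n)
    {B : ∀ j, Matrix (Fin (d j) × Fin (k j)) (Fin (d j) × Fin (k j)) R} :
    directSum h B = 0 ↔ ∀ j, B j = 0 := by
  rw [directSum, ← Matrix.coe_reindexLinearEquiv R, LinearEquiv.map_eq_zero_iff,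
    ← Matrix.blockDiagonal'_zero, Matrix.blockDiagonal'_inj, funext_iff]
  rfl

theorem minpoly_directSum {K : Type*} [Field K] {r n : ℕ} {d k : Fin r → ℕ}
    (h : ∑ j, d j * k j = n)
    {B : ∀ j, Matrix (Fin (d j) × Fin (k j)) (Fin (d j) × Fin (k j)) K}
    (hB : Pairwise (Function.onFun IsCoprime fun j => minpoly K (B j))) :
    minpoly K (directSum h B) = ∏ j, minpoly K (B j) := by
  have hdvd (q : K[X]) : minpoly K (directSum h B) ∣ q ↔ ∀ j, minpoly K (B j) ∣ q := by
    simp only [minpoly.dvd_iff, aeval_directSum, directSum_eq_zero_iff]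
  exact eq_of_monic_of_associated (minpoly.monic (Matrix.isIntegral _))
    (monic_prod_of_monic _ _ fun j _ => minpoly.monic (Matrix.isIntegral _))
    (associated_of_dvd_dvd ((hdvd _).mpr fun j => Finset.dvd_prod_of_mem _ (Finset.mem_univ j))
      (Fintype.prod_dvd_of_coprime hB ((hdvd _).mp dvd_rfl)))

end DirectSum

section CompanionSolution

theorem commute_of_aeval_eq {R A : Type*} [CommSemiring R] [Semiring A] [Algebra R A] {p : R[X]}
    {x a : A} (h : aeval x p = a) : Commute x a :=
  h ▸ commute_aeval_right (Commute.refl x) p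

variable {K : Type*} [Field K] {g p : K[X]} {M : Matrix (Fin g.natDegree) (Fin g.natDegree) K}

theorem commute_of_commute_companion (hg : g.Monic) (hM : aeval M p = companion g)
    {Z : Matrix (Fin g.natDegree) (Fin g.natDegree) K} (hZ : Commute Z (companion g)) :
    Commute Z M := by
  obtain ⟨q, rfl⟩ := exists_aeval_eq_of_commute_matrix
    (by rw [minpoly_companion hg, Fintype.card_fin]) (commute_of_aeval_eq hM)
  exact commute_aeval_right hZ q

theorem isUnit_aeval_derivative_of_delta_eq_one (hg : g.Monic) (hM : aeval M p = companion g)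
    {Z : Matrix (Fin g.natDegree) (Fin g.natDegree) K} (hZ : Delta p M M Z = 1) :
    IsUnit (aeval M (derivative p)) := by
  have hcomm : Commute Z M := commute_of_commute_companion hg hM
    (hM ▸ commute_aeval_of_commute_delta (hZ ▸ Commute.one_right M))
  rw [delta_apply_of_commute p hcomm] at hZ
  exact IsUnit.of_mul_eq_one _ hZ

theorem detCondition_iff_isUnit_aeval_derivative (hg : g.Monic) (hM : aeval M p = companion g) :
    DetCondition p M ↔ IsUnit (aeval M (derivative p)) := by
  refine ⟨fun h => ?_, fun h => ?_⟩
  · obtain ⟨Z, hZ, -⟩ := h.existsUnique_delta_eq 1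
    exact isUnit_aeval_derivative_of_delta_eq_one hg hM hZ
  · refine detCondition_iff_ker_deltaLinearMap_eq_bot.mpr (LinearMap.ker_eq_bot'.mpr fun Z hZ => ?_)
    change Delta p M M Z = 0 at hZ
    have hcomm : Commute Z M := commute_of_commute_companion hg hM
      (hM ▸ commute_aeval_of_commute_delta (hZ ▸ Commute.zero_right M))
    rwa [delta_apply_of_commute p hcomm, h.mul_right_eq_zero] at hZ

theorem detCondition_of_stepEquation_two (hg : g.Monic)
    {X : ℕ → Matrix (Fin g.natDegree) (Fin g.natDegree) K} (hX : aeval (X 1) p = companion g)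
    {Z : Matrix (Fin g.natDegree) (Fin g.natDegree) K} (hZ : StepEquation p X 2 Z) :
    DetCondition p (X 1) := by
  rw [StepEquation, if_pos rfl] at hZ
  exact (detCondition_iff_isUnit_aeval_derivative hg hX).mpr
    (isUnit_aeval_derivative_of_delta_eq_one hg hX hZ)

end CompanionSolution

section Solutions

/-- The set of solutions `x` of the polynomial equation `p(x) = a` in the algebra containing `a`. -/
def solutions {R A : Type*} [CommSemiring R] [Semiring A] [Algebra R A] (p : R[X]) (a : A) :
    Set A :=
  {x | aeval x p = a}

theorem mem_solutions {R A : Type*} [CommSemiring R] [Semiring A] [Algebra R A] {p : R[X]}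
    {x a : A} : x ∈ solutions p a ↔ aeval x p = a :=
  Iff.rfl

theorem encard_range_inter_solutions {R A B : Type*} [CommSemiring R] [Semiring A] [Semiring B]
    [Algebra R A] [Algebra R B] {φ : A →ₐ[R] B} (hφ : Function.Injective φ) (p : R[X]) (a : A) :
    ((φ.range : Set B) ∩ solutions p (φ a)).encard = (solutions p a).encard := by
  have himage : (φ.range : Set B) ∩ solutions p (φ a) = φ '' solutions p a := by
    ext y
    constructor
    · rintro ⟨⟨x, rfl⟩, h⟩
      exact ⟨x, hφ ((aeval_algHom_apply φ x p).symm.trans h), rfl⟩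
    · rintro ⟨x, rfl, rfl⟩
      exact ⟨⟨x, rfl⟩, aeval_algHom_apply φ x p⟩
  rw [himage, hφ.encard_image]

section MinpolyLift

variable {K A : Type*} [Field K] [Ring A] [Algebra K A]

variable (K) in
/-- The embedding of `K[X] ⧸ (minpoly K a)` into a possibly noncommutative algebra that sends the
root to `a`. (`AdjoinRoot.liftAlgHom` needs a commutative target.) -/
def minpolyLift (a : A) : AdjoinRoot (minpoly K a) →ₐ[K] A :=
  Ideal.Quotient.liftₐ _ (aeval a) fun _ hq =>
    minpoly.dvd_iff.mp (Ideal.mem_span_singleton.mp hq)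

theorem minpolyLift_mk (a : A) (q : K[X]) : minpolyLift K a (AdjoinRoot.mk _ q) = aeval a q :=
  rfl

theorem minpolyLift_root (a : A) : minpolyLift K a (AdjoinRoot.root _) = a :=
  (minpolyLift_mk a X).trans (aeval_X a)

theorem minpolyLift_injective (a : A) : Function.Injective (minpolyLift K a) := by
  refine (injective_iff_map_eq_zero _).mpr fun x hx => ?_
  obtain ⟨q, rfl⟩ := AdjoinRoot.mk_surjective x
  exact AdjoinRoot.mk_eq_zero.mpr (minpoly.dvd K a hx)

theorem range_minpolyLift (a : A) : (minpolyLift K a).range = Algebra.adjoin K {a} := by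
  rw [Algebra.adjoin_singleton_eq_range_aeval]
  exact le_antisymm (fun _ ⟨x, hx⟩ => (AdjoinRoot.mk_surjective x).imp fun q hq => by
    rw [← hx, ← hq]; rfl) fun _ ⟨q, hq⟩ => ⟨AdjoinRoot.mk _ q, hq⟩

theorem encard_adjoin_inter_solutions (p : K[X]) (a : A) :
    ((Algebra.adjoin K {a} : Set A) ∩ solutions p a).encard =
      (solutions p (AdjoinRoot.root (minpoly K a))).encard := by
  rw [← encard_range_inter_solutions (minpolyLift_injective a), minpolyLift_root,
    range_minpolyLift]

end MinpolyLift

theorem encard_solutions_matrix {K n : Type*} [Field K] [Fintype n] [DecidableEq n]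
    {M : Matrix n n K} (hM : (minpoly K M).natDegree = Fintype.card n) (p : K[X]) :
    (solutions p M).encard = (solutions p (AdjoinRoot.root (minpoly K M))).encard := by
  rw [← encard_adjoin_inter_solutions, Set.inter_eq_right.mpr fun X hX => ?_]
  obtain ⟨q, rfl⟩ := exists_aeval_eq_of_commute_matrix hM (commute_of_aeval_eq hX)
  exact aeval_mem_adjoin_singleton K M

/-- The set of solutions `μ ∈ K(z)` of the scalar equation `p(μ) = z`, for `z` in an extension
field of `K`. -/
def adjoinSolutions {K L : Type*} [Field K] [Field L] [Algebra K L] (p : K[X]) (z : L) : Set L :=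
  {μ | μ ∈ K⟮z⟯ ∧ aeval μ p = z}

theorem encard_adjoinSolutions {K L : Type*} [Field K] [Field L] [Algebra K L] {z : L}
    (hz : IsAlgebraic K z) (p : K[X]) :
    (adjoinSolutions p z).encard = (solutions p (AdjoinRoot.root (minpoly K z))).encard := by
  rw [← encard_adjoin_inter_solutions,
    ← IntermediateField.adjoin_simple_toSubalgebra_of_isAlgebraic hz]
  rfl

end Solutions

section SolutionLifting

theorem isUnit_of_isUnit_map_of_ker_nil {S T : Type*} [CommRing S] [Ring T] {π : S →+* T}
    (hπ : Function.Surjective π) (hnil : ∀ s, π s = 0 → IsNilpotent s) {s : S}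
    (hs : IsUnit (π s)) : IsUnit s := by
  obtain ⟨t', ht'⟩ := hs.exists_right_inv
  obtain ⟨t, rfl⟩ := hπ t'
  have hst : IsNilpotent (s * t - 1) := hnil _ (by rw [map_sub, map_mul, ht', map_one, sub_self])
  have hunit := hst.isUnit_add_one
  rw [sub_add_cancel] at hunit
  exact isUnit_of_mul_isUnit_left hunit

variable {K S T : Type*} [CommRing K] [CommRing S] [CommRing T] [Algebra K S] [Algebra K T]
  {π : S →ₐ[K] T}

theorem existsUnique_lift_solution [IsReduced T] (hπ : Function.Surjective π)
    (hnil : ∀ s, π s = 0 → IsNilpotent s) {p : K[X]} {x : S} {η : T} (hη : aeval η p = π x)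
    (hder : IsUnit (aeval η (derivative p))) : ∃! ξ, π ξ = η ∧ aeval ξ p = x := by
  obtain ⟨s, rfl⟩ := hπ η
  rw [aeval_algHom_apply] at hη hder
  have hclose (r : S) : IsNilpotent (s - r) ↔ π r = π s := by
    rw [eq_comm, ← sub_eq_zero, ← map_sub]
    exact ⟨fun h => (h.map π).eq_zero, hnil _⟩
  have heval (r : S) : aeval r (p.map (algebraMap K S) - C x) = aeval r p - x := by
    rw [map_sub, aeval_map_algebraMap, aeval_C, Algebra.algebraMap_self_apply]
  have h := existsUnique_nilpotent_sub_and_aeval_eq_zero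
    (P := p.map (algebraMap K S) - C x) (x := s)
    (hnil _ (by rw [heval, map_sub, hη, sub_self]))
    (isUnit_of_isUnit_map_of_ker_nil hπ hnil (by
      rwa [derivative_sub, derivative_C, sub_zero, derivative_map, aeval_map_algebraMap]))
  simpa only [hclose, heval, sub_eq_zero] using h

theorem encard_solutions_eq_of_ker_nil [IsReduced T] (hπ : Function.Surjective π)
    (hnil : ∀ s, π s = 0 → IsNilpotent s) {p : K[X]} (x : S)
    (hder : ∀ η ∈ solutions p (π x), IsUnit (aeval η (derivative p))) :
    (solutions p x).encard = (solutions p (π x)).encard := by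
  have hmaps : Set.MapsTo π (solutions p x) (solutions p (π x)) := fun ξ hξ => by
    rw [mem_solutions, aeval_algHom_apply, mem_solutions.mp hξ]
  have hlift (η) (hη : η ∈ solutions p (π x)) :=
    existsUnique_lift_solution hπ hnil hη (hder η hη)
  have hbij : Set.BijOn π (solutions p x) (solutions p (π x)) :=
    ⟨hmaps, fun ξ hξ ξ' hξ' h => (hlift _ (hmaps hξ)).unique ⟨rfl, hξ⟩ ⟨h.symm, hξ'⟩,
      fun η hη => (hlift η hη).exists.imp fun _ => And.symm⟩
  rw [← hbij.image_eq, hbij.injOn.encard_image]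

end SolutionLifting

section QuotientCounting

variable {K : Type*} [Field K]

theorem algHomOfDvd_mk {f g : K[X]} (h : g ∣ f) (q : K[X]) :
    AdjoinRoot.algHomOfDvd K f g h (AdjoinRoot.mk f q) = AdjoinRoot.mk g q := by
  rw [← AdjoinRoot.aeval_eq, ← aeval_algHom_apply, AdjoinRoot.algHomOfDvd_root, AdjoinRoot.aeval_eq]

theorem encard_solutions_root_pow {g : K[X]} (hirr : Irreducible g) {d : ℕ} (hd : 0 < d)
    {p : K[X]} (hder : ∀ η ∈ solutions p (AdjoinRoot.root g), aeval η (derivative p) ≠ 0) :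
    (solutions p (AdjoinRoot.root (g ^ d))).encard =
      (solutions p (AdjoinRoot.root g)).encard := by
  have : Fact (Irreducible g) := ⟨hirr⟩
  have hdvd : g ∣ g ^ d := dvd_pow_self g hd.ne'
  have hsurj : Function.Surjective (AdjoinRoot.algHomOfDvd K (g ^ d) g hdvd) := fun y => by
    obtain ⟨q, rfl⟩ := AdjoinRoot.mk_surjective y
    exact ⟨AdjoinRoot.mk _ q, algHomOfDvd_mk hdvd q⟩
  have hnil (s) (hs : AdjoinRoot.algHomOfDvd K (g ^ d) g hdvd s = 0) : IsNilpotent s := by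
    obtain ⟨q, rfl⟩ := AdjoinRoot.mk_surjective s
    rw [algHomOfDvd_mk, AdjoinRoot.mk_eq_zero] at hs
    exact ⟨d, by rw [← map_pow, AdjoinRoot.mk_eq_zero]; exact pow_dvd_pow_of_dvd hs d⟩
  rw [encard_solutions_eq_of_ker_nil hsurj hnil, AdjoinRoot.algHomOfDvd_root]
  rw [AdjoinRoot.algHomOfDvd_root]
  exact fun η hη => (hder η hη).isUnit

theorem encard_solutions_root_prod {ι : Type*} [Fintype ι] {f : ι → K[X]}
    (hcop : Pairwise (Function.onFun IsCoprime f)) (p : K[X]) :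
    (solutions p (AdjoinRoot.root (∏ j, f j))).encard =
      ∏ j, (solutions p (AdjoinRoot.root (f j))).encard := by
  have hdvd (j) : f j ∣ ∏ j, f j := Finset.dvd_prod_of_mem _ (Finset.mem_univ j)
  let Φ : AdjoinRoot (∏ j, f j) →ₐ[K] ∀ j, AdjoinRoot (f j) :=
    AlgHom.pi fun j => AdjoinRoot.algHomOfDvd K _ (f j) (hdvd j)
  have hmk (q j) : Φ (AdjoinRoot.mk _ q) j = AdjoinRoot.mk (f j) q := algHomOfDvd_mk (hdvd j) q
  have hinj : Function.Injective Φ := by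
    refine (injective_iff_map_eq_zero _).mpr fun x hx => ?_
    obtain ⟨q, rfl⟩ := AdjoinRoot.mk_surjective x
    refine AdjoinRoot.mk_eq_zero.mpr (Fintype.prod_dvd_of_coprime hcop fun j => ?_)
    rw [← AdjoinRoot.mk_eq_zero, ← hmk, hx, Pi.zero_apply]
  have hsurj : Function.Surjective Φ := fun y => by
    obtain ⟨q, hq⟩ := Ideal.pi_quotient_surjective (I := fun j => Ideal.span {f j})
      (fun i j hij => (Ideal.isCoprime_span_singleton_iff _ _).mpr (hcop hij)) y
    exact ⟨AdjoinRoot.mk _ q, funext fun j => (hmk q j).trans (hq j)⟩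
  have hpi : solutions p (Φ (AdjoinRoot.root _)) =
      Set.univ.pi fun j => solutions p (AdjoinRoot.root (f j)) := by
    ext y
    simp only [Set.mem_univ_pi, mem_solutions, funext_iff, aeval_pi_apply₂]
    exact forall_congr' fun j => by rw [AdjoinRoot.root, hmk, AdjoinRoot.root]
  rw [← encard_range_inter_solutions hinj, AlgHom.coe_range, hsurj.range_eq, Set.univ_inter, hpi,
    Set.encard_pi_eq_prod_encard]

end QuotientCounting

section Equation

theorem aeval_inv_mul_mul {R n : Type*} [CommRing R] [Fintype n] [DecidableEq n]
    {T : Matrix n n R} (hT : IsUnit T) (Y : Matrix n n R) (p : R[X]) :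
    aeval (T⁻¹ * Y * T) p = T⁻¹ * aeval Y p * T := by
  obtain ⟨u, rfl⟩ := hT
  simp only [← Matrix.coe_units_inv, aeval_eq_sum_range, Finset.mul_sum, Finset.sum_mul,
    Units.conj_pow', mul_smul_comm, smul_mul_assoc]

theorem aeval_conj_directSum_blockToeplitz {R : Type*} [CommRing R] {n r : ℕ} {g : Fin r → R[X]}
    {d : Fin r → ℕ} (h : ∑ j, d j * (g j).natDegree = n) {p : R[X]}
    {X : ∀ j, ℕ → Matrix (Fin (g j).natDegree) (Fin (g j).natDegree) R}
    (hX1 : ∀ j, aeval (X j 1) p = companion (g j))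
    (hX : ∀ j, ∀ s, 2 ≤ s → s ≤ d j → StepEquation p (X j) s (X j s))
    {A T : Matrix (Fin n) (Fin n) R} (hT : IsUnit T)
    (hA : A = T⁻¹ * directSum h (fun j => companionJordanBlock (d j) (g j)) * T) :
    aeval (T⁻¹ * directSum h (fun j => blockToeplitz (d j) (X j)) * T) p = A := by
  rw [aeval_inv_mul_mul hT, aeval_directSum, hA]
  simp only [fun j => aeval_blockToeplitz (hX1 j) (hX j)]

variable {K : Type*} [Field K]

theorem exists_eq_conj_directSum_companionJordanBlock {n r : ℕ} {A : Matrix (Fin n) (Fin n) K}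
    (hA : minpoly K A = A.charpoly) {g : Fin r → K[X]} {d : Fin r → ℕ}
    (hmonic : ∀ j, (g j).Monic) (hirr : ∀ j, Irreducible (g j)) (hsep : ∀ j, (g j).Separable)
    (hcop : Pairwise (Function.onFun IsCoprime g)) (hchar : A.charpoly = ∏ j, g j ^ d j) :
    ∃ T : Matrix (Fin n) (Fin n) K, IsUnit T ∧ A = T⁻¹ * directSum (size_eq hmonic hchar)
      (fun j => companionJordanBlock (d j) (g j)) * T := by
  have hblock (j) := minpoly_companionJordanBlock (hmonic j) (hirr j) (hsep j) (d j)
  have hsum : minpoly K (directSum (size_eq hmonic hchar)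
      fun j => companionJordanBlock (d j) (g j)) = ∏ j, g j ^ d j := by
    rw [minpoly_directSum _ fun i j hij => ?_, Finset.prod_congr rfl fun j _ => hblock j]
    simpa only [Function.onFun, hblock] using (hcop hij).pow
  obtain ⟨T, hT, hTA⟩ := exists_isUnit_mul_eq_mul_of_minpoly_eq
    (by rw [hA, Matrix.charpoly_natDegree_eq_dim]) (hA.trans (hchar.trans hsum.symm))
  exact ⟨T, hT, by rw [mul_assoc, ← hTA,
    Matrix.nonsing_inv_mul_cancel_left _ _ ((Matrix.isUnit_iff_isUnit_det T).mp hT)]⟩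

theorem aeval_derivative_ne_zero_of_detCondition {g p : K[X]} (hg : g.Monic) (hirr : Irreducible g)
    (hdet : ∀ M ∈ solutions p (companion g), DetCondition p M) {η : AdjoinRoot g}
    (hη : η ∈ solutions p (AdjoinRoot.root g)) : aeval η (derivative p) ≠ 0 := by
  have : Nonempty (Fin g.natDegree) := ⟨⟨0, hirr.natDegree_pos⟩⟩
  obtain ⟨q, rfl⟩ := AdjoinRoot.mk_surjective η
  have hmk (f : K[X]) : aeval (AdjoinRoot.mk g q) f = AdjoinRoot.mk g (f.comp q) := by
    rw [← AdjoinRoot.aeval_eq q, ← aeval_comp, AdjoinRoot.aeval_eq]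
  have hM : aeval (aeval (companion g) q) p = companion g := by
    rw [mem_solutions, hmk, AdjoinRoot.root, AdjoinRoot.mk_eq_mk,
      ← aeval_companion_eq_zero_iff hg, map_sub, aeval_X, sub_eq_zero, aeval_comp] at hη
    exact hη
  rw [hmk, Ne, AdjoinRoot.mk_eq_zero, ← aeval_companion_eq_zero_iff hg, aeval_comp]
  exact ((detCondition_iff_isUnit_aeval_derivative hg hM).mp (hdet _ hM)).ne_zero

theorem exists_forall_mem_solutions_companion {r : ℕ} {g : Fin r → K[X]} {d : Fin r → ℕ}
    {p : K[X]} (hsol : ∀ j, (solutions p (companion (g j))).Nonempty)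
    (hdet : ∀ j, 1 < d j → ∃ M ∈ solutions p (companion (g j)), DetCondition p M) :
    ∃ X₁ : ∀ j, Matrix (Fin (g j).natDegree) (Fin (g j).natDegree) K,
      ∀ j, X₁ j ∈ solutions p (companion (g j)) ∧ (1 < d j → DetCondition p (X₁ j)) := by
  have hblock (j) : ∃ M ∈ solutions p (companion (g j)), 1 < d j → DetCondition p M := by
    by_cases hj : 1 < d j
    · exact (hdet j hj).imp fun _ hM => ⟨hM.1, fun _ => hM.2⟩
    · exact (hsol j).imp fun _ hM => ⟨hM, fun h => absurd h hj⟩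
  choose X₁ hX₁ using hblock
  exact ⟨X₁, hX₁⟩

variable {L : Type*} [Field L] [Algebra K L]

variable (L) in
/-- The condition `EigenvalueCondition`, with the eigenvalues taken in an arbitrary extension
field `L` of the base field instead of `ℂ`. -/
def SpectrumCondition {k : ℕ} (p : K[X]) (X₁ : Matrix (Fin k) (Fin k) K) : Prop :=
  ∀ μ₁ ∈ spectrum L (X₁.map (algebraMap K L)), ∀ μ₂ ∈ spectrum L (X₁.map (algebraMap K L)),
    ∑ m ∈ Finset.Icc 1 p.natDegree,
      algebraMap K L (p.coeff m) * ∑ i ∈ Finset.range m, μ₁ ^ i * μ₂ ^ (m - 1 - i) ≠ 0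

variable (L) in
theorem detCondition_iff_spectrumCondition [IsAlgClosed L] {k : ℕ} (p : K[X])
    (X₁ : Matrix (Fin k) (Fin k) K) : DetCondition p X₁ ↔ SpectrumCondition L p X₁ := by
  rw [← detCondition_map (L := L), detCondition_iff_forall_mem_spectrum, natDegree_map]
  simp only [coeff_map, SpectrumCondition]

theorem adjoinSolutions_nonempty_of_mem_solutions {n : Type*} [Fintype n] [DecidableEq n]
    {A X : Matrix n n K} (hA : minpoly K A = A.charpoly) {p : K[X]} (hX : X ∈ solutions p A)
    {z : L} (hz : aeval z A.charpoly = 0) : (adjoinSolutions p z).Nonempty := by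
  obtain ⟨q, rfl⟩ := exists_aeval_eq_of_commute_matrix
    (by rw [hA, Matrix.charpoly_natDegree_eq_dim]) (commute_of_aeval_eq hX)
  have hdvd : minpoly K A ∣ p.comp q - Polynomial.X := minpoly.dvd K A (by
    rw [map_sub, aeval_comp, mem_solutions.mp hX, aeval_X, sub_self])
  have hroot := aeval_eq_zero_of_dvd_aeval_eq_zero (hA ▸ hdvd) hz
  rw [map_sub, aeval_comp, aeval_X, sub_eq_zero] at hroot
  exact ⟨aeval z q, IntermediateField.algebra_adjoin_le_adjoin K {z}
    (aeval_mem_adjoin_singleton K z), hroot⟩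

theorem encard_solutions_root {g : K[X]} (hg : g.Monic) (hirr : Irreducible g) {z : L}
    (hz : aeval z g = 0) (p : K[X]) :
    (solutions p (AdjoinRoot.root g)).encard = (adjoinSolutions p z).encard := by
  rw [encard_adjoinSolutions ⟨g, hg.ne_zero, hz⟩, ← minpoly.eq_of_irreducible_of_monic hirr hz hg]

theorem encard_solutions_companion {g : K[X]} (hg : g.Monic) (hirr : Irreducible g) {z : L}
    (hz : aeval z g = 0) (p : K[X]) :
    (solutions p (companion g)).encard = (adjoinSolutions p z).encard := by
  rw [encard_solutions_matrix (by rw [minpoly_companion hg, Fintype.card_fin]),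
    minpoly_companion hg, encard_solutions_root hg hirr hz]

theorem solutions_companion_nonempty [IsAlgClosed L] {g : K[X]} (hg : g.Monic)
    (hirr : Irreducible g) {p : K[X]}
    (h : ∀ z : L, aeval z g = 0 → (adjoinSolutions p z).Nonempty) :
    (solutions p (companion g)).Nonempty := by
  obtain ⟨z, hz⟩ := IsAlgClosed.exists_aeval_eq_zero L g hirr.degree_pos.ne'
  rw [← Set.encard_ne_zero, encard_solutions_companion hg hirr hz, Set.encard_ne_zero]
  exact h z hz

theorem encard_solutions_root_pow_of_detCondition {g : K[X]} (hg : g.Monic) (hirr : Irreducible g)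
    {d : ℕ} (hd : 0 < d) {p : K[X]}
    (hdet : 1 < d → ∀ M ∈ solutions p (companion g), DetCondition p M) {z : L}
    (hz : aeval z g = 0) :
    (solutions p (AdjoinRoot.root (g ^ d))).encard = (adjoinSolutions p z).encard := by
  rcases (Nat.one_le_iff_ne_zero.mpr hd.ne').eq_or_lt with rfl | h1
  · rw [pow_one, encard_solutions_root hg hirr hz]
  · rw [encard_solutions_root_pow hirr hd fun η =>
      aeval_derivative_ne_zero_of_detCondition hg hirr (hdet h1), encard_solutions_root hg hirr hz]

theorem encard_solutions_eq_prod {n : Type*} [Fintype n] [DecidableEq n] {A : Matrix n n K}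
    (hA : minpoly K A = A.charpoly) {r : ℕ} {g : Fin r → K[X]} {d : Fin r → ℕ}
    (hmonic : ∀ j, (g j).Monic) (hirr : ∀ j, Irreducible (g j))
    (hcop : Pairwise (Function.onFun IsCoprime g)) (hd : ∀ j, 0 < d j)
    (hchar : A.charpoly = ∏ j, g j ^ d j) {p : K[X]}
    (hdet : ∀ j, 1 < d j → ∀ M ∈ solutions p (companion (g j)), DetCondition p M)
    {z : Fin r → L} (hz : ∀ j, aeval (z j) (g j) = 0) :
    (solutions p A).encard = ∏ j, (adjoinSolutions p (z j)).encard := by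
  rw [encard_solutions_matrix (by rw [hA, Matrix.charpoly_natDegree_eq_dim]), hA, hchar,
    encard_solutions_root_prod fun i j hij => (hcop hij).pow]
  exact Finset.prod_congr rfl fun j _ =>
    encard_solutions_root_pow_of_detCondition (hmonic j) (hirr j) (hd j) (hdet j) (hz j)

end Equation

end PolyMatEq

end

theorem mainTheorem1_general {K L : Type*} [Field K] [Field L] [IsAlgClosed L] [Algebra K L]
    {n : ℕ} {A : Matrix (Fin n) (Fin n) K} (hA : minpoly K A = A.charpoly) {r : ℕ}
    {g : Fin r → K[X]} {d : Fin r → ℕ} (hmonic : ∀ j, (g j).Monic)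
    (hirr : ∀ j, Irreducible (g j)) (hsep : ∀ j, (g j).Separable)
    (hcop : Pairwise (Function.onFun IsCoprime g)) (hd : ∀ j, 0 < d j)
    (hchar : A.charpoly = ∏ j, g j ^ d j) (p : K[X]) :
    (∃ T : Matrix (Fin n) (Fin n) K, IsUnit T ∧
      A = T⁻¹ * directSum (size_eq hmonic hchar)
        (fun j => companionJordanBlock (d j) (g j)) * T) ∧
    (∀ j, ∀ X₁ ∈ solutions p (companion (g j)), DetCondition p X₁ ↔ SpectrumCondition L p X₁) ∧
    ((solutions p A).Nonempty →
      ∀ j, ∀ z : L, aeval z (g j) = 0 → (adjoinSolutions p z).Nonempty) ∧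
    ((∀ j, ∀ z : L, aeval z (g j) = 0 → (adjoinSolutions p z).Nonempty) →
      ∀ j, (solutions p (companion (g j))).Nonempty) ∧
    (∀ j, ∀ z : L, aeval z (g j) = 0 →
      (solutions p (companion (g j))).encard = (adjoinSolutions p z).encard) ∧
    ((∀ j, ∀ z : L, aeval z (g j) = 0 → (adjoinSolutions p z).Nonempty) →
      (∀ j, 1 < d j → ∃ X₁ ∈ solutions p (companion (g j)), DetCondition p X₁) →
      (∃ X₁ : ∀ j, Matrix (Fin (g j).natDegree) (Fin (g j).natDegree) K,
        ∀ j, X₁ j ∈ solutions p (companion (g j)) ∧ (1 < d j → DetCondition p (X₁ j))) ∧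
      ∀ X₁ : ∀ j, Matrix (Fin (g j).natDegree) (Fin (g j).natDegree) K,
        (∀ j, X₁ j ∈ solutions p (companion (g j)) ∧ (1 < d j → DetCondition p (X₁ j))) →
        ∃ X : ∀ j, ℕ → Matrix (Fin (g j).natDegree) (Fin (g j).natDegree) K,
          (∀ j, X j 1 = X₁ j) ∧
          (∀ j, ∀ s, 2 ≤ s → s ≤ d j → ∀ Z, StepEquation p (X j) s Z ↔ Z = X j s) ∧
          ∀ T : Matrix (Fin n) (Fin n) K, IsUnit T →
            A = T⁻¹ * directSum (size_eq hmonic hchar)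
              (fun j => companionJordanBlock (d j) (g j)) * T →
            T⁻¹ * directSum (size_eq hmonic hchar) (fun j => blockToeplitz (d j) (X j)) * T ∈
              solutions p A) ∧
    ((∀ j, 1 < d j → ∀ X₁ ∈ solutions p (companion (g j)), DetCondition p X₁) →
      ∀ z : Fin r → L, (∀ j, aeval (z j) (g j) = 0) →
        (solutions p A).encard = ∏ j, (adjoinSolutions p (z j)).encard) ∧
    (∀ X : ∀ j, ℕ → Matrix (Fin (g j).natDegree) (Fin (g j).natDegree) K,
      (∀ j, X j 1 ∈ solutions p (companion (g j))) →
      (∀ j, ∀ s, 2 ≤ s → s ≤ d j → StepEquation p (X j) s (X j s)) →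
      (∀ T : Matrix (Fin n) (Fin n) K, IsUnit T →
        A = T⁻¹ * directSum (size_eq hmonic hchar)
          (fun j => companionJordanBlock (d j) (g j)) * T →
        T⁻¹ * directSum (size_eq hmonic hchar) (fun j => blockToeplitz (d j) (X j)) * T ∈
          solutions p A) ∧
      ((∃ j, 1 < d j ∧ ¬ DetCondition p (X j 1)) → (solutions p A).Infinite)) := by
  have hdvd (j) : g j ∣ A.charpoly :=
    hchar ▸ (dvd_pow_self _ (hd j).ne').trans (Finset.dvd_prod_of_mem _ (Finset.mem_univ j))
  have hcompanion (h : ∀ j, ∀ z : L, aeval z (g j) = 0 → (adjoinSolutions p z).Nonempty) (j) :=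
    solutions_companion_nonempty (hmonic j) (hirr j) (h j)
  refine ⟨exists_eq_conj_directSum_companionJordanBlock hA hmonic hirr hsep hcop hchar,
    fun j X₁ _ => detCondition_iff_spectrumCondition L p X₁, ?existence, hcompanion,
    fun j z hz => encard_solutions_companion (hmonic j) (hirr j) hz p, ?construction,
    fun hdet z hz => encard_solutions_eq_prod hA hmonic hirr hcop hd hchar hdet hz,
    fun X hX1 hX => ⟨fun T => aeval_conj_directSum_blockToeplitz _ hX1 hX, ?infinite⟩⟩
  case existence =>
    exact fun ⟨X, hX⟩ j z hz => adjoinSolutions_nonempty_of_mem_solutions hA hX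
      (aeval_eq_zero_of_dvd_aeval_eq_zero (hdvd j) hz)
  case construction =>
    refine fun h hdet =>
      ⟨exists_forall_mem_solutions_companion (hcompanion h) hdet, fun X₁ hX₁ => ?_⟩
    choose X hX1 hX using fun j => exists_forall_stepEquation_iff_eq (hX₁ j).2
    exact ⟨X, hX1, hX, fun T => aeval_conj_directSum_blockToeplitz _
      (fun j => hX1 j ▸ (hX₁ j).1) fun j s h2 hs => (hX j s h2 hs _).mpr rfl⟩
  case infinite =>
    exact fun ⟨j, hj, hdet⟩ => absurd
      (detCondition_of_stepEquation_two (hmonic j) (hX1 j) (hX j 2 le_rfl hj)) hdet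

theorem mainTheorem1 (H : Subfield ℂ) (n : ℕ) (A : Matrix (Fin n) (Fin n) H)
    (hA : Nonderogatory A) (r : ℕ) (g : Fin r → H[X]) (d : Fin r → ℕ)
    (hmonic : ∀ j, (g j).Monic) (hirr : ∀ j, Irreducible (g j))
    (hcop : Pairwise (Function.onFun IsCoprime g)) (hd : ∀ j, 0 < d j)
    (hchar : A.charpoly = ∏ j, g j ^ d j) (p : H[X]) :
    -- existence of the companion-Jordan form
    (∃ T : Matrix (Fin n) (Fin n) H, IsUnit T ∧
      A = T⁻¹ * directSum (size_eq hmonic hchar)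
        (fun j => companionJordanBlock (d j) (g j)) * T) ∧
    -- the determinant condition and the eigenvalue condition are equivalent
    (∀ j, ∀ X₁ : Matrix (Fin (g j).natDegree) (Fin (g j).natDegree) H,
      aeval X₁ p = companion (g j) → (DetCondition p X₁ ↔ EigenvalueCondition p X₁)) ∧
    -- (i)
    ((∃ X : Matrix (Fin n) (Fin n) H, aeval X p = A) →
      ∀ j, ∀ z : ℂ, aeval z (g j) = 0 → (scalarSolutions p z).Nonempty) ∧
    -- (ii)
    ((∀ j, ∀ z : ℂ, aeval z (g j) = 0 → (scalarSolutions p z).Nonempty) →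
      ∀ j, ∃ X₁ : Matrix (Fin (g j).natDegree) (Fin (g j).natDegree) H,
        aeval X₁ p = companion (g j)) ∧
    (∀ j, ∀ z : ℂ, aeval z (g j) = 0 →
      {X₁ : Matrix (Fin (g j).natDegree) (Fin (g j).natDegree) H |
        aeval X₁ p = companion (g j)}.encard = (scalarSolutions p z).encard) ∧
    -- (iii)
    ((∀ j, ∀ z : ℂ, aeval z (g j) = 0 → (scalarSolutions p z).Nonempty) →
      (∀ j, 1 < d j → ∃ X₁ : Matrix (Fin (g j).natDegree) (Fin (g j).natDegree) H,
        aeval X₁ p = companion (g j) ∧ DetCondition p X₁) →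
      (∃ X₁ : ∀ j, Matrix (Fin (g j).natDegree) (Fin (g j).natDegree) H,
        ∀ j, aeval (X₁ j) p = companion (g j) ∧ (1 < d j → DetCondition p (X₁ j))) ∧
      ∀ X₁ : ∀ j, Matrix (Fin (g j).natDegree) (Fin (g j).natDegree) H,
        (∀ j, aeval (X₁ j) p = companion (g j) ∧ (1 < d j → DetCondition p (X₁ j))) →
        ∃ X : ∀ j, ℕ → Matrix (Fin (g j).natDegree) (Fin (g j).natDegree) H,
          (∀ j, X j 1 = X₁ j) ∧
          (∀ j, ∀ s, 2 ≤ s → s ≤ d j → ∀ Z, StepEquation p (X j) s Z ↔ Z = X j s) ∧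
          ∀ T : Matrix (Fin n) (Fin n) H, IsUnit T →
            A = T⁻¹ * directSum (size_eq hmonic hchar)
              (fun j => companionJordanBlock (d j) (g j)) * T →
            aeval (T⁻¹ * directSum (size_eq hmonic hchar)
              (fun j => blockToeplitz (d j) (X j)) * T) p = A) ∧
    -- (iv)
    ((∀ j, 1 < d j → ∀ X₁ : Matrix (Fin (g j).natDegree) (Fin (g j).natDegree) H,
        aeval X₁ p = companion (g j) → DetCondition p X₁) →
      ∀ z : Fin r → ℂ, (∀ j, aeval (z j) (g j) = 0) →
        {X : Matrix (Fin n) (Fin n) H | aeval X p = A}.encard =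
          ∏ j, (scalarSolutions p (z j)).encard) ∧
    -- (v)
    (∀ X : ∀ j, ℕ → Matrix (Fin (g j).natDegree) (Fin (g j).natDegree) H,
      (∀ j, aeval (X j 1) p = companion (g j)) →
      (∀ j, ∀ s, 2 ≤ s → s ≤ d j → StepEquation p (X j) s (X j s)) →
      (∀ T : Matrix (Fin n) (Fin n) H, IsUnit T →
        A = T⁻¹ * directSum (size_eq hmonic hchar)
          (fun j => companionJordanBlock (d j) (g j)) * T →
        aeval (T⁻¹ * directSum (size_eq hmonic hchar)
          (fun j => blockToeplitz (d j) (X j)) * T) p = A) ∧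
      ((∃ j, 1 < d j ∧ ¬ DetCondition p (X j 1)) →
        {X' : Matrix (Fin n) (Fin n) H | aeval X' p = A}.Infinite)) := by
  exact mainTheorem1_general (L := ℂ) hA.minpoly_eq_charpoly hmonic hirr
    (fun j => (hirr j).separable) hcop hd hchar p
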